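/- Let $(W,S)$ be a Coxeter system with identity $e$, length function $\ell$ and Bruhat order $\le$, whose covering relation is $u\lhd v$ iff $u^{-1}v$ is a reflection and $\ell(v)=\ell(u)+1$. For $H\subseteq S$ let $W_H$ be the parabolic subgroup generated by $H$, let $W^H$ (resp. ${}^HW$) be the set of elements without right (resp. left) descents in $H$, and write $u=u^H u_H={}_Hu\,{}^Hu$ for the unique factorizations with $u^H\in W^H$, $u_H,{}_Hu\in W_H$, ${}^Hu\in{}^HW$. Let $\mathrm{Supp}_H(u)=\{h\in H: h\le u\}$, let $C_s=\{c\in S: sc=cs\}$, and let $w_0(H)$ be the longest element of $[e,w]\cap W_H$. Write $\lambda_\alpha(u)=\alpha u$ and $\rho_\beta(u)=u\beta$. A matching of $[e,x]$ is an involution $M$ of $[e,x]$ such that, for every $u\in[e,x]$, $u\lhd M(u)$ or $M(u)\lhd u$; it is a multiplication matching if it equals $\lambda_r$ or $\rho_r$ on $[e,x]$ for some $r\in S$. "$M$ commutes with $\lambda_\alpha$" (or $\rho_\beta$) means that this multiplication maps the interval on which $M$ is defined to itself and commutes with $M$ there. A system for $w\in W$ is a triple $\mathcal S=(J,H,M)$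 with $H\subseteq S$, $|H|\in\{1,2\}$, $M$ a matching of $[e,w_0(H)]$, and $C_s\subseteq J\subseteq S$ where $s=M(e)$, such that, with $K=(S\setminus J)\cup C_s$: - $M$ is a multiplication matching if and only if $|H|=1$; - $w^J\in W_K$; - $|\mathrm{Supp}_H((w^J)^H)|\le 1$, and $M$ commutes with $\lambda_\alpha$ for $\alpha\in \mathrm{Supp}_H((w^J)^H)$; likewise $|\mathrm{Supp}_H({}^H({}^Kw))|\le1$, and $M$ commutes with $\rho_\beta$ for $\beta\in\mathrm{Supp}_H({}^H({}^Kw))$. An $\mathcal S$-factorization of $u$ is a factorization $u=abc$ with $\ell(u)=\ell(a)+\ell(b)+\ell(c)$, $a\in W_K\cap W^H$, $b\in W_H$, $c\in W_J\cap {}^HW$, $|\mathrm{Supp}_H(a)|\le1$, $|\mathrm{Supp}_H(c)|\le 1$, $M$ commuting with $\lambda_\alpha$ for $\alpha\in\mathrm{Supp}_H(a)$ and with $\rho_\beta$ for $\beta\in\mathrm{Supp}_H(c)$. For $u\le w$ put $M_{\mathcal S}(u)=a\,M(b)\,c$ for an arbitrary $\mathcal S$-factorization $u=abc$. **Statement.**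 Let $\mathcal S=(J,H,M)$ be a system for $w$. Every $u\le w$ has an $\mathcal S$-factorization, and $M_{\mathcal S}(u)$ does not depend on its choice. If moreover $M_{\mathcal S}(w)\lhd w$, then: 1. $M_{\mathcal S}(u)\le w$ for all $u\in[e,w]$; 2. $M_{\mathcal S}$ restricts to a matching of $[e,w]$; 3. if $H\subseteq K$, then $(u^J)^H\, M\big((u^J)_H\;{}_H(u_J)\big)\,{}^H(u_J)\le w$ for all $u\le w$ (the inequality of axiom R2); 4. if $H\subseteq J$, then $({}_Ku)^H\, M\big(({}_Ku)_H\;{}_H({}^Ku)\big)\,{}^H({}^Ku)\le w$ for all $u\le w$ (the inequality of axiom L2). -/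

import Mathlib

noncomputable section

namespace CoxeterSystem

variable {B W : Type*} [Group W] {A : CoxeterMatrix B} (cs : CoxeterSystem A W)

/-! The set `S` of Coxeter generators is indexed by `B` through `cs.simple`, so subsets
of `S` are given as sets of indices. -/

/-- The covering relation `u ⊲ v` of the Bruhat order. -/
def BruhatCovers (u v : W) : Prop :=
  cs.IsReflection (u⁻¹ * v) ∧ cs.length u + 1 = cs.length v

/-- The Bruhat order `u ≤ v`. -/
def BruhatLE (u v : W) : Prop := Relation.ReflTransGen cs.BruhatCovers u v

theorem BruhatLE.length_le {cs : CoxeterSystem A W} {u v : W} (h : cs.BruhatLE u v) :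
    cs.length u ≤ cs.length v := by
  unfold BruhatLE at h
  induction h with
  | refl => exact le_rfl
  | tail _ hbc ih => have := hbc.2; omega

theorem bruhatLE_refl (u : W) : cs.BruhatLE u u := Relation.ReflTransGen.refl

/-- The support of `w`: all `s ∈ S` with `s ≤ w`. -/
def supp (w : W) : Set B := {i | cs.BruhatLE (cs.simple i) w}

/-- `Supp_H(w)`. -/
def suppIn (H : Set B) (w : W) : Set B := cs.supp w ∩ H

/-- `C_x`: the generators that commute with `x`. -/
def commGens (x : W) : Set B := {i | x * cs.simple i = cs.simple i * x}

/-- `J` and `K` are `x`-complementary (used for `x ∈ S`). -/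
def IsComplementary (x : W) (J K : Set B) : Prop :=
  J ∪ K = Set.univ ∧ J ∩ K = cs.commGens x

/-- The `x`-complement of `J` (for `C_x ⊆ J`). -/
def complement (x : W) (J : Set B) : Set B := Jᶜ ∪ cs.commGens x

theorem isComplementary_iff {x : W} {J K : Set B} (h : cs.commGens x ⊆ J) :
    cs.IsComplementary x J K ↔ K = cs.complement x J := by
  unfold IsComplementary complement
  constructor
  · rintro ⟨h1, h2⟩
    rw [← h2]
    ext i
    have : i ∈ J ∪ K := h1 ▸ Set.mem_univ i
    simp only [Set.mem_union, Set.mem_inter_iff, Set.mem_compl_iff] at this ⊢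
    tauto
  · rintro rfl
    constructor
    · ext i; simp only [Set.mem_union, Set.mem_compl_iff, Set.mem_univ, iff_true]; tauto
    · ext i
      have := @h i
      simp only [Set.mem_union, Set.mem_inter_iff, Set.mem_compl_iff]; tauto

/-- The parabolic subgroup `W_J`. -/
def parabolic (J : Set B) : Subgroup W := Subgroup.closure (cs.simple '' J)

/-- `W^J`: the elements without right descents in `J`. -/
def rightMin (J : Set B) : Set W := {w | ∀ i ∈ J, ¬ cs.IsRightDescent w i}

/-- `^J W`: the elements without left descents in `J`. -/
def leftMin (J : Set B) : Set W := {w | ∀ i ∈ J, ¬ cs.IsLeftDescent w i}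

theorem exists_right_factorization (J : Set B) (w : W) :
    ∃ x ∈ cs.rightMin J, ∃ y ∈ cs.parabolic J, w = x * y := by
  induction h : cs.length w using Nat.strong_induction_on generalizing w with
  | _ n ih =>
    by_cases hw : w ∈ cs.rightMin J
    · exact ⟨w, hw, 1, Subgroup.one_mem _, by simp⟩
    · simp only [rightMin, Set.mem_ofPred_eq, not_forall, not_not] at hw
      obtain ⟨i, hi, hd⟩ := hw
      obtain ⟨x, hx, y, hy, hxy⟩ := ih _ (h ▸ hd) (w * cs.simple i) rfl
      refine ⟨x, hx, y * cs.simple i, Subgroup.mul_mem _ hy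
        (Subgroup.subset_closure ⟨i, hi, rfl⟩), ?_⟩
      rw [← mul_assoc, ← hxy, simple_mul_simple_cancel_right]

theorem exists_left_factorization (J : Set B) (w : W) :
    ∃ x ∈ cs.leftMin J, ∃ y ∈ cs.parabolic J, w = y * x := by
  obtain ⟨x, hx, y, hy, h⟩ := cs.exists_right_factorization J w⁻¹
  refine ⟨x⁻¹, fun i hi => ?_, y⁻¹, Subgroup.inv_mem _ hy, ?_⟩
  · rw [isLeftDescent_inv_iff]; exact hx i hi
  · rw [← mul_inv_rev, ← h, inv_inv]

/-- `w^J`, where `w = w^J w_J` with `w^J ∈ W^J` and `w_J ∈ W_J`. -/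
def upR (J : Set B) (w : W) : W := (cs.exists_right_factorization J w).choose

/-- `w_J`, where `w = w^J w_J` with `w^J ∈ W^J` and `w_J ∈ W_J`. -/
def downR (J : Set B) (w : W) : W := (cs.exists_right_factorization J w).choose_spec.2.choose

/-- `^J w`, where `w = (_J w) (^J w)` with `_J w ∈ W_J` and `^J w ∈ ^J W`. -/
def upL (J : Set B) (w : W) : W := (cs.exists_left_factorization J w).choose

/-- `_J w`, where `w = (_J w) (^J w)` with `_J w ∈ W_J` and `^J w ∈ ^J W`. -/
def downL (J : Set B) (w : W) : W := (cs.exists_left_factorization J w).choose_spec.2.choose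

theorem right_factorization_spec (J : Set B) (w : W) :
    cs.upR J w ∈ cs.rightMin J ∧ cs.downR J w ∈ cs.parabolic J ∧
      w = cs.upR J w * cs.downR J w :=
  ⟨(cs.exists_right_factorization J w).choose_spec.1,
    (cs.exists_right_factorization J w).choose_spec.2.choose_spec⟩

theorem left_factorization_spec (J : Set B) (w : W) :
    cs.upL J w ∈ cs.leftMin J ∧ cs.downL J w ∈ cs.parabolic J ∧
      w = cs.downL J w * cs.upL J w :=
  ⟨(cs.exists_left_factorization J w).choose_spec.1,
    (cs.exists_left_factorization J w).choose_spec.2.choose_spec⟩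

theorem one_bruhatLE (w : W) : cs.BruhatLE 1 w := by
  induction h : cs.length w using Nat.strong_induction_on generalizing w with
  | _ n ih =>
    by_cases hw : w = 1
    · subst hw; exact cs.bruhatLE_refl _
    · obtain ⟨i, hi⟩ := cs.exists_rightDescent_of_ne_one hw
      refine Relation.ReflTransGen.tail (ih _ (h ▸ hi) _ rfl) ⟨?_, cs.isRightDescent_iff.1 hi⟩
      simpa using cs.isReflection_simple i

theorem exists_longest (H : Set B) (w : W) :
    ∃ x, cs.BruhatLE x w ∧ x ∈ cs.parabolic H ∧
      ∀ y, cs.BruhatLE y w → y ∈ cs.parabolic H → cs.length y ≤ cs.length x := by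
  by_contra! hcon
  have key : ∀ n : ℕ, ∃ x, cs.BruhatLE x w ∧ x ∈ cs.parabolic H ∧ n ≤ cs.length x := by
    intro n
    induction n with
    | zero => exact ⟨1, cs.one_bruhatLE w, Subgroup.one_mem _, Nat.zero_le _⟩
    | succ n ih =>
      obtain ⟨x, h1, h2, h3⟩ := ih
      obtain ⟨y, h4, h5, h6⟩ := hcon x h1 h2
      exact ⟨y, h4, h5, by omega⟩
  obtain ⟨x, h1, _, h3⟩ := key (cs.length w + 1)
  have := h1.length_le
  omega

/-- `w_0(H)`: the longest element of `[e, w] ∩ W_H`. -/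
def longestBelow (H : Set B) (w : W) : W := (cs.exists_longest H w).choose

/-- `M` is a matching of (the Hasse diagram of) the lower Bruhat interval `[e, x]`. Only the
values of `M` on `[e, x]` matter, here and below. -/
def IsMatching (x : W) (M : W → W) : Prop :=
  ∀ u, cs.BruhatLE u x → cs.BruhatLE (M u) x ∧ M (M u) = u ∧
    (cs.BruhatCovers u (M u) ∨ cs.BruhatCovers (M u) u)

/-- `M` agrees on `[e, x]` with the left or right multiplication by a Coxeter generator. -/
def IsMultiplication (x : W) (M : W → W) : Prop :=
  (∃ i, ∀ u, cs.BruhatLE u x → M u = cs.simple i * u) ∨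
    (∃ i, ∀ u, cs.BruhatLE u x → M u = u * cs.simple i)

/-- `λ_i` maps `[e, x]` to itself and commutes there with `M`. -/
def CommutesLeft (x : W) (M : W → W) (i : B) : Prop :=
  ∀ u, cs.BruhatLE u x →
    cs.BruhatLE (cs.simple i * u) x ∧ M (cs.simple i * u) = cs.simple i * M u

/-- `ρ_i` maps `[e, x]` to itself and commutes there with `M`. -/
def CommutesRight (x : W) (M : W → W) (i : B) : Prop :=
  ∀ u, cs.BruhatLE u x →
    cs.BruhatLE (u * cs.simple i) x ∧ M (u * cs.simple i) = M u * cs.simple i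

/-- The triple `(J, H, M)` is a system for `w`; here `M` is a matching of `[e, w_0(H)]`. -/
structure IsSystem (w : W) (J H : Set B) (M : W → W) : Prop where
  card_eq : H.encard = 1 ∨ H.encard = 2
  matching : cs.IsMatching (cs.longestBelow H w) M
  commGens_subset : cs.commGens (M 1) ⊆ J
  s0 : cs.IsMultiplication (cs.longestBelow H w) M ↔ H.encard = 1
  s1 : cs.upR J w ∈ cs.parabolic (cs.complement (M 1) J)
  s2_left_card : (cs.suppIn H (cs.upR H (cs.upR J w))).encard ≤ 1
  s2_left : ∀ i ∈ cs.suppIn H (cs.upR H (cs.upR J w)),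
    cs.CommutesLeft (cs.longestBelow H w) M i
  s2_right_card : (cs.suppIn H (cs.upL H (cs.upL (cs.complement (M 1) J) w))).encard ≤ 1
  s2_right : ∀ i ∈ cs.suppIn H (cs.upL H (cs.upL (cs.complement (M 1) J) w)),
    cs.CommutesRight (cs.longestBelow H w) M i

/-- `u = a · b · c` is an `𝒮`-factorization of `u`, for the system `𝒮 = (J, H, M)` for `w`. -/
structure IsFactorization (w : W) (J H : Set B) (M : W → W) (u a b c : W) : Prop where
  eq_mul : u = a * b * c
  length_eq : cs.length u = cs.length a + cs.length b + cs.length c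
  left_parabolic : a ∈ cs.parabolic (cs.complement (M 1) J)
  left_min : a ∈ cs.rightMin H
  left_card : (cs.suppIn H a).encard ≤ 1
  left_comm : ∀ i ∈ cs.suppIn H a, cs.CommutesLeft (cs.longestBelow H w) M i
  mid_parabolic : b ∈ cs.parabolic H
  right_parabolic : c ∈ cs.parabolic J
  right_min : c ∈ cs.leftMin H
  right_card : (cs.suppIn H c).encard ≤ 1
  right_comm : ∀ i ∈ cs.suppIn H c, cs.CommutesRight (cs.longestBelow H w) M i

open Classical in
/-- The map `M_𝒮` of the system `𝒮 = (J, H, M)` for `w`: `M_𝒮(u) = a M(b) c` for an arbitrary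
`𝒮`-factorization `u = a · b · c`. -/
def systemMap (w : W) (J H : Set B) (M : W → W) (u : W) : W :=
  if h : ∃ p : W × W × W, cs.IsFactorization w J H M u p.1 p.2.1 p.2.2 then
    h.choose.1 * M h.choose.2.1 * h.choose.2.2
  else u

end CoxeterSystem

end

/-!
Write `s = M(e)`, `K = (S \ J) ∪ C_s`, and call `u = a b c` as in the definition of an
`𝒮`-factorization simply a factorization. The proof has two halves.

*Factorizations.* If `|H| = 2`, the two elements of `H` do not commute, since every matching of a
commutative dihedral interval is a multiplication matching. Hence `H ⊆ K` or `H ⊆ J`, and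
`H ∩ J ⊆ {s}` in the first case. Inversion exchanges `J` and `K` (`IsSystem.inv`), so let `H ⊆ K`.
Then `u = (u^J)^H · ((u^J)_H · _H(u_J)) · ^H(u_J)` is a factorization
(`IsRightSystem.isFactorization_canonical`). For an arbitrary factorization `u = a b c` put
`b = p q` with `q ∈ {e, s}` and `p < p s`. If `a p ∈ W^J`, the factorization is the canonical one.
Otherwise `a p` has a right descent `r ∈ C_s \ H`, so the reflection `p r p⁻¹` is an inversion of
`a` and lies in the parabolic subgroup of the support of `a`. By Deodhar's lemma this forces either
that `r` commutes with `W_H`, in which case `r` can be moved from `a` to `c`, or that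
`p ∈ W_{Supp_H(a)}`, in which case `p` can be pulled out of `M` and the value is `u^J s u_J`
(`IsRightSystem.descent_mul`, `IsRightSystem.mul_map_mul_eq`). The same dichotomy shows that for
the canonical factorization `a · M(b) · c` is again a factorization
(`IsRightSystem.isFactorization_map_canonical`). So `M_𝒮` is well defined, `M_𝒮(u)` covers or is
covered by `u`, and `M_𝒮` is an involution as soon as it preserves `[e, w]`.

*The interval is preserved.* Let `w = a b c` be such a factorization. If `M_𝒮(w) ⊲ w` then
`M(b) ⊲ b`, and `M` preserves `[e, b]` because `[e, b]` is dihedral (`IsMatching.le_of_le`).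
An element `u ≤ w` is a length-additive product `a' b' c'` with `a' ≤ a`, `b' ≤ b`, `c' ≤ c`. The
`W_H`-parts of `a'` and `c'` commute with `M`, so `M_𝒮(u) = a' M(b') c' ≤ a b c`
(`IsSystem.systemMap_le`). The inequalities of R2 and L2 are the special case of the canonical
factorizations of `(J, H, M)` and of its inverse.

The tools are the strong exchange property, in the form of a cocycle identity for inversions
(`isRightInversion_mul_iff`), which gives the lifting property and the subword property for
length-additive products, and the geometric representation, which is used only to see that
`s_i ∈ W_J` implies `i ∈ J`.
-/

namespace CoxeterSystem

variable {B W : Type*} [Group W] {A : CoxeterMatrix B} (cs : CoxeterSystem A W)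

/-! ### The geometric representation -/

open Polynomial.Chebyshev in
/-- Two reflections `r_x`, `r_y` with `f(y) = g(x) = -2 cos (π / m)` satisfy the braid relation
of order `m`. -/
theorem reflection_mul_reflection_pow_eq_one {V : Type*} [AddCommGroup V] [Module ℝ V]
    {x y : V} {f g : Module.Dual ℝ V} (hf : f x = 2) (hg : g y = 2) {m : ℕ} (hm : 2 ≤ m)
    (hfy : f y = -2 * Real.cos (Real.pi / m)) (hgx : g x = -2 * Real.cos (Real.pi / m)) :
    (Module.reflection hf * Module.reflection hg) ^ m = 1 := by
  rcases hm.eq_or_lt with rfl | hm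
  · have h0 : f y = 0 := by rw [hfy]; norm_num
    have h1 : g x = 0 := by rw [hgx]; norm_num
    ext z
    simp only [pow_two, LinearEquiv.mul_apply, Module.reflection_apply, map_sub, map_smul, hf, hg,
      h0, h1, LinearEquiv.coe_one, id]
    module
  have hm0 : (m : ℝ) ≠ 0 := by positivity
  set θ : ℝ := 2 * Real.pi / m with hθ
  have ht : 2 * Real.cos θ = f y * g x - 2 := by
    have : θ = 2 * (Real.pi / m) := by rw [hθ]; ring
    rw [this, Real.cos_two_mul, hfy, hgx]; ring
  have hsin : Real.sin θ ≠ 0 := by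
    have h3 : (3 : ℝ) ≤ m := by exact_mod_cast hm
    refine (Real.sin_pos_of_pos_of_lt_pi (by positivity) ?_).ne'
    rw [hθ, div_lt_iff₀ (by positivity)]
    nlinarith [Real.pi_pos]
  have hS : ∀ n : ℤ, (S ℝ n).eval (2 * Real.cos θ) = Real.sin ((n + 1) * θ) / Real.sin θ := by
    intro n
    rw [eq_div_iff hsin, S_two_mul_real_cos]
  have hmθ : (m : ℝ) * θ = 2 * Real.pi := by rw [hθ]; field_simp
  have key : (S ℝ (((m : ℤ) - 2) / 2)).eval (2 * Real.cos θ) *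
        ((S ℝ (((m : ℤ) - 1) / 2)).eval (2 * Real.cos θ) +
          (S ℝ (((m : ℤ) - 3) / 2)).eval (2 * Real.cos θ)) = 0 ∧
      (S ℝ (((m : ℤ) - 1) / 2)).eval (2 * Real.cos θ) *
        ((S ℝ ((m : ℤ) / 2)).eval (2 * Real.cos θ) +
          (S ℝ (((m : ℤ) - 2) / 2)).eval (2 * Real.cos θ)) = 0 := by
    obtain ⟨k, hk⟩ | ⟨k, hk⟩ := Nat.even_or_odd m
    · have e1 : ((m : ℤ) - 2) / 2 = k - 1 := by omega
      have e2 : ((m : ℤ) - 1) / 2 = k - 1 := by omega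
      have hz : Real.sin ((((k : ℤ) - 1 : ℤ) + 1) * θ) = 0 := by
        have : ((((k : ℤ) - 1 : ℤ) : ℝ) + 1) * θ = Real.pi := by
          have h2 : (m : ℝ) = 2 * k := by rw [hk]; push_cast; ring
          rw [h2] at hmθ
          push_cast; linarith
        rw [this, Real.sin_pi]
      rw [e1, e2, hS ((k : ℤ) - 1), hz]
      simp
    · have e1 : ((m : ℤ) - 2) / 2 = k - 1 := by omega
      have e2 : ((m : ℤ) - 1) / 2 = k := by omega
      have e3 : ((m : ℤ) - 3) / 2 = k - 1 := by omega
      have e4 : (m : ℤ) / 2 = k := by omega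
      have hz : Real.sin ((((k : ℤ)) + 1) * θ) + Real.sin ((((k : ℤ) - 1 : ℤ) + 1) * θ) = 0 := by
        have h2 : (m : ℝ) = 2 * k + 1 := by rw [hk]; push_cast; ring
        rw [h2] at hmθ
        have : ((((k : ℤ) - 1 : ℤ) : ℝ) + 1) * θ = 2 * Real.pi - ((k : ℤ) + 1) * θ := by
          push_cast; linarith
        rw [this, Real.sin_two_pi_sub]; ring
      have hz' : (S ℝ (k : ℤ)).eval (2 * Real.cos θ) +
          (S ℝ ((k : ℤ) - 1)).eval (2 * Real.cos θ) = 0 := by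
        rw [hS, hS, ← add_div, hz, zero_div]
      rw [e1, e2, e3, e4, hz']
      simp
  ext z
  have := Module.reflection_mul_reflection_pow_apply hf hg m z _ ht
  rw [this, key.1, key.2]
  simp

/-- The linear form `v ↦ 2 B(e_i, v)` on the space of the geometric representation, where
`B(e_i, e_j) = - cos (π / m_{ij})`. An infinite `m_{ij}` is encoded by `0`, so that
`π / m_{ij} = 0` and `B(e_i, e_j) = -1`, as it should be. -/
noncomputable def geomForm (A : CoxeterMatrix B) (i : B) : Module.Dual ℝ (B →₀ ℝ) :=
  Finsupp.linearCombination ℝ fun j => -2 * Real.cos (Real.pi / A i j)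

theorem geomForm_single (i j : B) :
    geomForm A i (Finsupp.single j 1) = -2 * Real.cos (Real.pi / A i j) := by
  simp [geomForm]

theorem geomForm_self (i : B) : geomForm A i (Finsupp.single i 1) = 2 := by
  simp [geomForm_single]

theorem isLiftable_geomReflection :
    A.IsLiftable fun i => Module.reflection (geomForm_self (A := A) i) := by
  intro i j
  rcases eq_or_ne i j with rfl | hij
  · ext v
    simp [Module.involutive_reflection (geomForm_self (A := A) i) v, LinearEquiv.mul_apply]
  rcases Nat.lt_or_ge (A i j) 2 with h | h
  · have h1 := A.off_diagonal i j hij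
    have h0 : A i j = 0 := by omega
    simp [h0]
  · refine reflection_mul_reflection_pow_eq_one _ _ h (geomForm_single i j) ?_
    rw [geomForm_single, A.symmetric]

/-- The geometric representation of a Coxeter group. -/
noncomputable def geomRep : W →* ((B →₀ ℝ) ≃ₗ[ℝ] (B →₀ ℝ)) :=
  cs.lift ⟨_, isLiftable_geomReflection⟩

theorem geomRep_simple (i : B) (v : B →₀ ℝ) :
    cs.geomRep (cs.simple i) v = v - geomForm A i v • Finsupp.single i 1 := by
  rw [geomRep, lift_apply_simple, Module.reflection_apply]

/-- The coefficient of `e_i` in a vector is not changed by `W_J` when `i ∉ J`, while `s_i` maps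
`e_i` to `-e_i`. -/
theorem mem_of_simple_mem_parabolic {J : Set B} {i : B} (h : cs.simple i ∈ cs.parabolic J) :
    i ∈ J := by
  by_contra hi
  have key : ∀ w ∈ cs.parabolic J, ∀ v : B →₀ ℝ, cs.geomRep w v i = v i := by
    intro w hw
    induction hw using Subgroup.closure_induction with
    | mem x hx =>
      obtain ⟨j, hj, rfl⟩ := hx
      intro v
      have : j ≠ i := fun h => hi (h ▸ hj)
      simp [geomRep_simple, this]
    | one => simp
    | mul x y _ _ hx hy => intro v; rw [map_mul, LinearEquiv.mul_apply, hx, hy]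
    | inv x _ hx =>
      intro v
      rw [← hx, ← LinearEquiv.mul_apply, ← map_mul, mul_inv_cancel, map_one]
      rfl
  have := key _ h (Finsupp.single i 1)
  rw [geomRep_simple, geomForm_self] at this
  norm_num at this

theorem simple_injective : Function.Injective cs.simple := by
  intro i j h
  have : cs.simple i ∈ cs.parabolic {j} := h ▸ Subgroup.subset_closure ⟨j, rfl, rfl⟩
  exact cs.mem_of_simple_mem_parabolic (J := {j}) this

/-! ### The inversion cocycle and the exchange property -/

open Classical in
/-- The action of a generator on `W × ZMod 2`: it conjugates the first component and flips the
sign exactly at the generator itself. -/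
noncomputable def signedConj (i : B) : Function.End (W × ZMod 2) := fun p =>
  (cs.simple i * p.1 * cs.simple i, p.2 + if p.1 = cs.simple i then 1 else 0)

theorem simple_mul_pow_eq (i j : B) (k : ℕ) :
    cs.simple j * (cs.simple i * cs.simple j) ^ k =
      ((cs.simple i * cs.simple j) ^ k)⁻¹ * cs.simple j := by
  induction k with
  | zero => simp
  | succ k ih =>
    rw [pow_succ, ← mul_assoc, ih, mul_inv_rev]
    have : cs.simple j * (cs.simple i * cs.simple j) =
      (cs.simple i * cs.simple j)⁻¹ * cs.simple j := by simp [mul_assoc]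
    rw [mul_assoc, this, ← mul_assoc, ← mul_inv_rev, ← mul_inv_rev, (Commute.self_pow _ k).eq]

open Classical in
theorem signedConj_mul_pow_apply (i j : B) (n : ℕ) (x : W) (ε : ZMod 2) :
    ((cs.signedConj i * cs.signedConj j) ^ n) (x, ε) =
      ((cs.simple i * cs.simple j) ^ n * x * ((cs.simple i * cs.simple j) ^ n)⁻¹,
        ε + ∑ k ∈ Finset.range (2 * n),
          if x = ((cs.simple i * cs.simple j) ^ k)⁻¹ * cs.simple j then 1 else 0) := by
  have hjc := cs.simple_mul_pow_eq i j
  set c := cs.simple i * cs.simple j with hc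
  induction n with
  | zero => simp; rfl
  | succ n ih =>
    have e1 : (c ^ n * x * (c ^ n)⁻¹ = cs.simple j) ↔ x = (c ^ (2 * n))⁻¹ * cs.simple j := by
      have : (c ^ (2 * n))⁻¹ * cs.simple j = (c ^ n)⁻¹ * cs.simple j * c ^ n := by
        simp only [two_mul, pow_add, mul_inv_rev, mul_assoc, hjc]
      rw [this, mul_inv_eq_iff_eq_mul, mul_assoc, eq_inv_mul_iff_mul_eq]
    have e2 : (cs.simple j * (c ^ n * x * (c ^ n)⁻¹) * cs.simple j = cs.simple i) ↔
        x = (c ^ (2 * n + 1))⁻¹ * cs.simple j := by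
      have : (c ^ (2 * n + 1))⁻¹ * cs.simple j =
          (c ^ n)⁻¹ * (cs.simple j * cs.simple i * cs.simple j) * c ^ n := by
        have h2 : c ^ (2 * n + 1) = c ^ n * (c * c ^ n) := by
          rw [← pow_succ', ← pow_add]; congr 1; ring
        rw [h2, mul_inv_rev, mul_inv_rev, mul_assoc, mul_assoc, mul_assoc, mul_assoc, hjc]
        have h3 : c⁻¹ = cs.simple j * cs.simple i := by simp [hc]
        rw [← h3]
      rw [this, eq_comm, eq_comm (a := x)]
      constructor
      · intro h; rw [h]; simp [mul_assoc]
      · rintro rfl; simp [mul_assoc]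
    rw [pow_succ' (cs.signedConj i * cs.signedConj j)]
    change cs.signedConj i (cs.signedConj j (((cs.signedConj i * cs.signedConj j) ^ n) (x, ε))) = _
    rw [ih]
    simp only [signedConj, e1, e2]
    refine Prod.ext ?_ ?_
    · have h4 : (c ^ (n + 1))⁻¹ = (c ^ n)⁻¹ * (cs.simple j * cs.simple i) := by
        simp [pow_succ', hc]
      rw [h4, pow_succ' c n, hc]
      simp only [mul_assoc]
    · rw [show 2 * (n + 1) = 2 * n + 1 + 1 by ring, Finset.sum_range_succ, Finset.sum_range_succ]
      ring

theorem isLiftable_signedConj : A.IsLiftable cs.signedConj := by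
  classical
  intro i j
  funext ⟨x, ε⟩
  rw [signedConj_mul_pow_apply, simple_mul_simple_pow]
  have hper : ∀ k, (cs.simple i * cs.simple j) ^ (A i j + k) = (cs.simple i * cs.simple j) ^ k := by
    intro k; rw [pow_add, simple_mul_simple_pow, one_mul]
  refine Prod.ext (by simp; rfl) ?_
  rw [two_mul, Finset.sum_range_add]
  simp only [hper, CharTwo.add_self_eq_zero, add_zero]
  rfl

/-- The permutation representation of `W` on `W × ZMod 2` behind the strong exchange property. -/
noncomputable def signedConjRep : W →* Function.End (W × ZMod 2) :=
  cs.lift ⟨_, cs.isLiftable_signedConj⟩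

/-- The inversion cocycle: for a reflection `t` it is `1` if `ℓ (w t) < ℓ w` and `0` otherwise. -/
noncomputable def invCocycle (w x : W) : ZMod 2 := (cs.signedConjRep w (x, 0)).2

theorem signedConjRep_apply (w x : W) (ε : ZMod 2) :
    cs.signedConjRep w (x, ε) = (w * x * w⁻¹, ε + cs.invCocycle w x) := by
  induction w using cs.simple_induction_left generalizing x ε with
  | one =>
    have h : ∀ p, cs.signedConjRep 1 p = p := fun p => by rw [map_one]; rfl
    simp [invCocycle, h]
  | mul_simple_left w i ih =>
    have h : ∀ p, cs.signedConjRep (cs.simple i * w) p =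
        cs.signedConj i (cs.signedConjRep w p) := by
      intro p
      rw [map_mul, signedConjRep, lift_apply_simple]
      rfl
    have h2 : cs.invCocycle (cs.simple i * w) x =
        (cs.signedConj i (cs.signedConjRep w (x, 0))).2 := by rw [invCocycle, h]
    rw [h, h2, ih, ih]
    simp [signedConj, mul_assoc, add_assoc]

theorem invCocycle_one (x : W) : cs.invCocycle 1 x = 0 := by
  rw [invCocycle, map_one]; rfl

theorem invCocycle_mul (v w x : W) :
    cs.invCocycle (v * w) x = cs.invCocycle w x + cs.invCocycle v (w * x * w⁻¹) := by
  have : cs.signedConjRep (v * w) (x, 0) = cs.signedConjRep v (cs.signedConjRep w (x, 0)) := by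
    rw [map_mul]; rfl
  simp only [signedConjRep_apply] at this
  simpa using congrArg Prod.snd this

open Classical in
theorem invCocycle_simple (i : B) (x : W) :
    cs.invCocycle (cs.simple i) x = if x = cs.simple i then 1 else 0 := by
  simp [invCocycle, signedConjRep, signedConj]

theorem invCocycle_self {t : W} (ht : cs.IsReflection t) : cs.invCocycle t t = 1 := by
  obtain ⟨u, i, rfl⟩ := ht
  have h1 : cs.invCocycle (u⁻¹ * u) (cs.simple i) = 0 := by simp [invCocycle_one]
  rw [invCocycle_mul] at h1
  have h2 : cs.invCocycle u (cs.simple i) + cs.invCocycle u⁻¹ (u * cs.simple i * u⁻¹) = 0 := h1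
  have h3 : u⁻¹ * (u * cs.simple i * u⁻¹) * u⁻¹⁻¹ = cs.simple i := by simp [mul_assoc]
  rw [invCocycle_mul, h3, invCocycle_mul]
  simp only [invCocycle_simple, if_true, inv_simple]
  simp only [simple_mul_simple_self, one_mul]
  rw [add_comm 1, ← add_assoc, add_comm (cs.invCocycle u⁻¹ _), h2, zero_add]

theorem mem_rightInvSeq_of_invCocycle_ne_zero (ω : List B) (x : W)
    (h : cs.invCocycle (cs.wordProd ω) x ≠ 0) : x ∈ cs.rightInvSeq ω := by
  induction ω with
  | nil => simp [invCocycle_one] at h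
  | cons i ω ih =>
    rw [wordProd_cons, invCocycle_mul, invCocycle_simple] at h
    rw [rightInvSeq, List.mem_cons]
    split_ifs at h with hx
    · left; rw [← hx]; simp [mul_assoc]
    · right; exact ih (by simpa using h)

/-- The strong exchange property in terms of the inversion cocycle. -/
theorem isRightInversion_iff_invCocycle {w t : W} (ht : cs.IsReflection t) :
    cs.IsRightInversion w t ↔ cs.invCocycle w t = 1 := by
  have key : ∀ w, cs.invCocycle w t ≠ 0 → cs.IsRightInversion w t := by
    intro w h
    obtain ⟨ω, hω, rfl⟩ := cs.exists_isReduced w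
    exact cs.isRightInversion_of_mem_rightInvSeq hω
      (cs.mem_rightInvSeq_of_invCocycle_ne_zero ω t h)
  constructor
  · intro h
    by_contra hne
    have h0 : cs.invCocycle w t = 0 := by
      generalize cs.invCocycle w t = z at hne
      revert z; decide
    have h1 : cs.invCocycle (w * t) t = 1 := by
      rw [invCocycle_mul, cs.invCocycle_self ht]
      simp [h0]
    exact ht.isRightInversion_mul_left_iff.1 (key _ (by rw [h1]; decide)) h
  · intro h; exact key w (by rw [h]; decide)

/-- The cocycle identity for the inversions of a product. It contains the strong exchange property
and is the form in which that property is used. -/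
theorem isRightInversion_mul_iff {v w t : W} (ht : cs.IsReflection t) :
    cs.IsRightInversion (v * w) t ↔
      Xor (cs.IsRightInversion w t) (cs.IsRightInversion v (w * t * w⁻¹)) := by
  rw [cs.isRightInversion_iff_invCocycle ht, cs.isRightInversion_iff_invCocycle ht,
    cs.isRightInversion_iff_invCocycle (ht.conj w), invCocycle_mul]
  generalize cs.invCocycle w t = y
  generalize cs.invCocycle v _ = z
  unfold Xor
  revert y z; decide

/-! ### Parabolic subgroups and minimal coset representatives -/

theorem simple_mem_parabolic {J : Set B} {i : B} (hi : i ∈ J) : cs.simple i ∈ cs.parabolic J :=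
  Subgroup.subset_closure ⟨i, hi, rfl⟩

theorem parabolic_mono {J K : Set B} (h : J ⊆ K) : cs.parabolic J ≤ cs.parabolic K :=
  Subgroup.closure_mono (Set.image_mono h)

theorem not_isRightInversion_one (t : W) : ¬ cs.IsRightInversion 1 t := by
  rintro ⟨_, h⟩
  simp at h

theorem IsRightInversion.mem_parabolic {cs : CoxeterSystem A W} {J : Set B} {y t : W}
    (h : cs.IsRightInversion y t) (hy : y ∈ cs.parabolic J) : t ∈ cs.parabolic J := by
  induction hy using Subgroup.closure_induction generalizing t with
  | mem x hx =>
    obtain ⟨j, hj, rfl⟩ := hx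
    have h2 := h.2
    rw [length_simple, Nat.lt_one_iff, length_eq_zero_iff, mul_eq_one_iff_eq_inv] at h2
    rw [← inv_inv t, ← h2]
    exact inv_mem (cs.simple_mem_parabolic hj)
  | one => exact absurd h (cs.not_isRightInversion_one t)
  | mul x y _ hy ihx ihy =>
    rcases (cs.isRightInversion_mul_iff h.1).1 h with ⟨h, _⟩ | ⟨h, _⟩
    · exact ihy h
    · have := mul_mem (mul_mem (inv_mem hy) (ihx h)) hy
      simpa [parabolic, mul_assoc] using this
  | inv x hx ih =>
    have h1 := cs.not_isRightInversion_one t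
    rw [← mul_inv_cancel x, cs.isRightInversion_mul_iff h.1] at h1
    have h2 : cs.IsRightInversion x (x⁻¹ * t * x⁻¹⁻¹) := by
      by_contra hc
      exact h1 (Or.inl ⟨h, hc⟩)
    have := mul_mem (mul_mem hx (ih h2)) (inv_mem hx)
    simpa [parabolic, mul_assoc] using this

theorem mem_of_isRightDescent {J : Set B} {y : W} (hy : y ∈ cs.parabolic J) {i : B}
    (hi : cs.IsRightDescent y i) : i ∈ J :=
  cs.mem_of_simple_mem_parabolic
    (((cs.isRightInversion_simple_iff_isRightDescent y i).2 hi).mem_parabolic hy)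

theorem mem_of_isLeftDescent {J : Set B} {y : W} (hy : y ∈ cs.parabolic J) {i : B}
    (hi : cs.IsLeftDescent y i) : i ∈ J :=
  cs.mem_of_isRightDescent (inv_mem hy) (cs.isRightDescent_inv_iff.2 hi)

theorem length_mul_of_forall_not_isRightInversion {J : Set B} {x y : W}
    (hx : ∀ t ∈ cs.parabolic J, ¬ cs.IsRightInversion x t) (hy : y ∈ cs.parabolic J) :
    cs.length (x * y) = cs.length x + cs.length y := by
  induction h : cs.length y generalizing y with
  | zero => rw [cs.length_eq_zero_iff.1 h]; simp
  | succ n ih =>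
    have hne : y ≠ 1 := by rintro rfl; simp at h
    obtain ⟨i, hi⟩ := cs.exists_rightDescent_of_ne_one hne
    have hiJ := cs.simple_mem_parabolic (cs.mem_of_isRightDescent hy hi)
    have hi' := cs.isRightDescent_iff.1 hi
    have hz := mul_mem hy hiJ
    have ih' := ih hz (by omega)
    have hni : ¬ cs.IsRightDescent (x * (y * cs.simple i)) i := by
      rw [← isRightInversion_simple_iff_isRightDescent,
        cs.isRightInversion_mul_iff (cs.isReflection_simple i)]
      rintro (⟨h, _⟩ | ⟨h, _⟩)
      · rw [isRightInversion_simple_iff_isRightDescent, IsRightDescent,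
          simple_mul_simple_cancel_right] at h
        omega
      · exact hx _ (mul_mem (mul_mem hz hiJ) (inv_mem hz)) h
    have := cs.not_isRightDescent_iff.1 hni
    rw [mul_assoc, simple_mul_simple_cancel_right] at this
    omega

theorem not_isRightInversion_of_mem_rightMin {J : Set B} {x : W} (hx : x ∈ cs.rightMin J) :
    ∀ t ∈ cs.parabolic J, ¬ cs.IsRightInversion x t := by
  -- compare `x` with an element of minimal length of its coset
  obtain ⟨z, hz, hmin⟩ : ∃ z ∈ cs.parabolic J, ∀ z' ∈ cs.parabolic J,
      cs.length (x * z) ≤ cs.length (x * z') := by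
    have hne : (cs.parabolic J : Set W).Nonempty := ⟨1, one_mem _⟩
    exact ⟨_, Function.argminOn_mem (fun z => cs.length (x * z)) _ hne, fun z' hz' =>
      Function.argminOn_le (fun z => cs.length (x * z)) _ hz'⟩
  have hx0 : ∀ t ∈ cs.parabolic J, ¬ cs.IsRightInversion (x * z) t := by
    intro t ht h
    have := hmin _ (mul_mem hz ht)
    rw [← mul_assoc] at this
    exact absurd h.2 (by omega)
  suffices z = 1 by simpa [this] using hx0
  by_contra hne
  obtain ⟨i, hi⟩ := cs.exists_rightDescent_of_ne_one (inv_ne_one.2 hne)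
  have hiJ := cs.mem_of_isRightDescent (inv_mem hz) hi
  have h1 := cs.length_mul_of_forall_not_isRightInversion hx0 (inv_mem hz)
  have h2 := cs.length_mul_of_forall_not_isRightInversion hx0
    (mul_mem (inv_mem hz) (cs.simple_mem_parabolic hiJ))
  rw [← mul_assoc, mul_inv_cancel_right] at h2
  rw [mul_inv_cancel_right] at h1
  refine hx i hiJ ?_
  unfold IsRightDescent at hi ⊢
  omega

theorem length_mul_of_mem_rightMin {J : Set B} {x y : W} (hx : x ∈ cs.rightMin J)
    (hy : y ∈ cs.parabolic J) : cs.length (x * y) = cs.length x + cs.length y :=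
  cs.length_mul_of_forall_not_isRightInversion (cs.not_isRightInversion_of_mem_rightMin hx) hy

theorem inv_mem_leftMin_iff {J : Set B} {x : W} : x⁻¹ ∈ cs.leftMin J ↔ x ∈ cs.rightMin J :=
  forall₂_congr fun _ _ => not_congr cs.isLeftDescent_inv_iff

theorem inv_mem_rightMin_iff {J : Set B} {x : W} : x⁻¹ ∈ cs.rightMin J ↔ x ∈ cs.leftMin J :=
  forall₂_congr fun _ _ => not_congr cs.isRightDescent_inv_iff

theorem length_mul_of_mem_leftMin {J : Set B} {x y : W} (hx : x ∈ cs.leftMin J)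
    (hy : y ∈ cs.parabolic J) : cs.length (y * x) = cs.length y + cs.length x := by
  have := cs.length_mul_of_mem_rightMin (cs.inv_mem_rightMin_iff.2 hx) (inv_mem hy)
  rw [← mul_inv_rev, length_inv, length_inv, length_inv] at this
  omega

theorem eq_of_mul_eq_mul_of_mem_rightMin {J : Set B} {x x' y y' : W} (hx : x ∈ cs.rightMin J)
    (hx' : x' ∈ cs.rightMin J) (hy : y ∈ cs.parabolic J) (hy' : y' ∈ cs.parabolic J)
    (h : x * y = x' * y') : x = x' ∧ y = y' := by
  have hz := mul_mem hy (inv_mem hy')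
  have e1 : x * (y * y'⁻¹) = x' := by rw [← mul_assoc, h, mul_inv_cancel_right]
  have e2 : x' * (y * y'⁻¹)⁻¹ = x := by rw [← e1, mul_inv_cancel_right]
  have h1 := cs.length_mul_of_mem_rightMin hx hz
  have h2 := cs.length_mul_of_mem_rightMin hx' (inv_mem hz)
  rw [e1] at h1
  rw [e2, length_inv] at h2
  have h3 : y * y'⁻¹ = 1 := cs.length_eq_zero_iff.1 (by omega)
  rw [h3, mul_one] at e1
  exact ⟨e1, mul_inv_eq_one.1 h3⟩

section Factorization

variable {J : Set B} {w x y : W}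

theorem upR_mem (J : Set B) (w : W) : cs.upR J w ∈ cs.rightMin J :=
  (cs.right_factorization_spec J w).1

theorem downR_mem (J : Set B) (w : W) : cs.downR J w ∈ cs.parabolic J :=
  (cs.right_factorization_spec J w).2.1

theorem upR_mul_downR (J : Set B) (w : W) : cs.upR J w * cs.downR J w = w :=
  (cs.right_factorization_spec J w).2.2.symm

theorem upL_mem (J : Set B) (w : W) : cs.upL J w ∈ cs.leftMin J :=
  (cs.left_factorization_spec J w).1

theorem downL_mem (J : Set B) (w : W) : cs.downL J w ∈ cs.parabolic J :=
  (cs.left_factorization_spec J w).2.1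

theorem downL_mul_upL (J : Set B) (w : W) : cs.downL J w * cs.upL J w = w :=
  (cs.left_factorization_spec J w).2.2.symm

theorem upR_mul (hx : x ∈ cs.rightMin J) (hy : y ∈ cs.parabolic J) : cs.upR J (x * y) = x :=
  (cs.eq_of_mul_eq_mul_of_mem_rightMin (cs.upR_mem J _) hx (cs.downR_mem J _) hy
    (cs.upR_mul_downR J _)).1

theorem downR_mul (hx : x ∈ cs.rightMin J) (hy : y ∈ cs.parabolic J) : cs.downR J (x * y) = y :=
  (cs.eq_of_mul_eq_mul_of_mem_rightMin (cs.upR_mem J _) hx (cs.downR_mem J _) hy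
    (cs.upR_mul_downR J _)).2

theorem upR_inv (J : Set B) (w : W) : cs.upR J w⁻¹ = (cs.upL J w)⁻¹ := by
  conv_lhs => rw [← cs.downL_mul_upL J w, mul_inv_rev]
  exact cs.upR_mul (cs.inv_mem_rightMin_iff.2 (cs.upL_mem J w)) (inv_mem (cs.downL_mem J w))

theorem downR_inv (J : Set B) (w : W) : cs.downR J w⁻¹ = (cs.downL J w)⁻¹ := by
  conv_lhs => rw [← cs.downL_mul_upL J w, mul_inv_rev]
  exact cs.downR_mul (cs.inv_mem_rightMin_iff.2 (cs.upL_mem J w)) (inv_mem (cs.downL_mem J w))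

theorem upL_inv (J : Set B) (w : W) : cs.upL J w⁻¹ = (cs.upR J w)⁻¹ := by
  rw [← inv_inv (cs.upL J w⁻¹), ← upR_inv, inv_inv]

theorem downL_inv (J : Set B) (w : W) : cs.downL J w⁻¹ = (cs.downR J w)⁻¹ := by
  rw [← inv_inv (cs.downL J w⁻¹), ← downR_inv, inv_inv]

theorem upL_mul (hx : x ∈ cs.leftMin J) (hy : y ∈ cs.parabolic J) : cs.upL J (y * x) = x := by
  rw [← inv_inj, ← upR_inv, mul_inv_rev]
  exact cs.upR_mul (cs.inv_mem_rightMin_iff.2 hx) (inv_mem hy)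

theorem downL_mul (hx : x ∈ cs.leftMin J) (hy : y ∈ cs.parabolic J) :
    cs.downL J (y * x) = y := by
  rw [← inv_inj, ← downR_inv, mul_inv_rev]
  exact cs.downR_mul (cs.inv_mem_rightMin_iff.2 hx) (inv_mem hy)

theorem length_upR_add (J : Set B) (w : W) :
    cs.length (cs.upR J w) + cs.length (cs.downR J w) = cs.length w := by
  rw [← cs.length_mul_of_mem_rightMin (cs.upR_mem J w) (cs.downR_mem J w), upR_mul_downR]

theorem length_downL_add (J : Set B) (w : W) :
    cs.length (cs.downL J w) + cs.length (cs.upL J w) = cs.length w := by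
  rw [← cs.length_mul_of_mem_leftMin (cs.upL_mem J w) (cs.downL_mem J w), downL_mul_upL]

end Factorization

/-! ### The Bruhat order -/

theorem BruhatLE.trans {cs : CoxeterSystem A W} {u v w : W} (h : cs.BruhatLE u v)
    (h' : cs.BruhatLE v w) : cs.BruhatLE u w := Relation.ReflTransGen.trans h h'

theorem BruhatCovers.le {cs : CoxeterSystem A W} {u v : W} (h : cs.BruhatCovers u v) :
    cs.BruhatLE u v := Relation.ReflTransGen.single h

theorem BruhatLE.eq_of_length_le {cs : CoxeterSystem A W} {u v : W} (h : cs.BruhatLE u v)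
    (hl : cs.length v ≤ cs.length u) : u = v := by
  rcases Relation.ReflTransGen.cases_head h with h | ⟨c, h1, h2⟩
  · exact h
  · have := h1.2
    have : cs.length c ≤ cs.length v := BruhatLE.length_le h2
    omega

theorem bruhatCovers_mul {u t : W} (ht : cs.IsReflection t)
    (h : cs.length (u * t) = cs.length u + 1) : cs.BruhatCovers u (u * t) :=
  ⟨by simpa using ht, h.symm⟩

theorem bruhatCovers_mul_simple {u : W} {i : B} (h : ¬ cs.IsRightDescent u i) :
    cs.BruhatCovers u (u * cs.simple i) :=
  cs.bruhatCovers_mul (cs.isReflection_simple i) (cs.not_isRightDescent_iff.1 h)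

theorem mul_simple_bruhatCovers {u : W} {i : B} (h : cs.IsRightDescent u i) :
    cs.BruhatCovers (u * cs.simple i) u := by
  have := cs.bruhatCovers_mul_simple (cs.isRightDescent_iff_not_isRightDescent_mul.1 h)
  rwa [simple_mul_simple_cancel_right] at this

theorem BruhatCovers.inv {cs : CoxeterSystem A W} {u v : W} (h : cs.BruhatCovers u v) :
    cs.BruhatCovers u⁻¹ v⁻¹ := by
  refine ⟨?_, by simpa using h.2⟩
  have h1 := (h.1.conj u).inv ▸ (h.1.conj u)
  simpa [mul_assoc, h.1.inv] using h1

theorem BruhatLE.inv {cs : CoxeterSystem A W} {u v : W} (h : cs.BruhatLE u v) :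
    cs.BruhatLE u⁻¹ v⁻¹ := by
  unfold BruhatLE at h
  induction h with
  | refl => exact cs.bruhatLE_refl _
  | tail _ h ih => exact ih.tail h.inv

theorem inv_bruhatLE_inv {u v : W} : cs.BruhatLE u⁻¹ v⁻¹ ↔ cs.BruhatLE u v :=
  ⟨fun h => by simpa using h.inv, fun h => h.inv⟩

theorem inv_bruhatLE {u v : W} : cs.BruhatLE u⁻¹ v ↔ cs.BruhatLE u v⁻¹ := by
  rw [← inv_bruhatLE_inv, inv_inv]

open Classical in
/-- The larger one of `u` and `u s_i`. -/
noncomputable def upStep (i : B) (u : W) : W :=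
  if cs.IsRightDescent u i then u else u * cs.simple i

open Classical in
/-- The smaller one of `u` and `u s_i`. -/
noncomputable def downStep (i : B) (u : W) : W :=
  if cs.IsRightDescent u i then u * cs.simple i else u

theorem upStep_of_not_descent {i : B} {u : W} (h : ¬ cs.IsRightDescent u i) :
    cs.upStep i u = u * cs.simple i := if_neg h

theorem downStep_of_descent {i : B} {u : W} (h : cs.IsRightDescent u i) :
    cs.downStep i u = u * cs.simple i := if_pos h

theorem downStep_of_not_descent {i : B} {u : W} (h : ¬ cs.IsRightDescent u i) :
    cs.downStep i u = u := if_neg h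

theorem downStep_le (i : B) (u : W) : cs.BruhatLE (cs.downStep i u) u := by
  unfold downStep
  split_ifs with h
  · exact (cs.mul_simple_bruhatCovers h).le
  · exact cs.bruhatLE_refl u

theorem le_upStep (i : B) (u : W) : cs.BruhatLE u (cs.upStep i u) := by
  unfold upStep
  split_ifs with h
  · exact cs.bruhatLE_refl u
  · exact (cs.bruhatCovers_mul_simple h).le

theorem mul_simple_le_upStep (i : B) (u : W) :
    cs.BruhatLE (u * cs.simple i) (cs.upStep i u) := by
  unfold upStep
  split_ifs with h
  · exact (cs.mul_simple_bruhatCovers h).le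
  · exact cs.bruhatLE_refl _

/-- The key step of the lifting property: multiplication by a generator can shrink a covering
pair only by exchanging its two elements. -/
theorem mul_simple_eq_of_bruhatCovers {u v : W} {i : B} (h : cs.BruhatCovers u v)
    (hu : ¬ cs.IsRightDescent u i) (hv : cs.IsRightDescent v i) : u * cs.simple i = v := by
  by_contra hne
  have hv' := cs.isRightDescent_iff.1 hv
  have hu' := cs.not_isRightDescent_iff.1 hu
  have hl := h.2
  have hvt : v * (u⁻¹ * v) = u := by
    rw [← h.1.inv]; group
  have hinv : cs.IsRightInversion (v * cs.simple i * cs.simple i) (u⁻¹ * v) := by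
    refine ⟨h.1, ?_⟩
    rw [simple_mul_simple_cancel_right, hvt]; omega
  rcases (cs.isRightInversion_mul_iff h.1).1 hinv with ⟨⟨_, h1⟩, _⟩ | ⟨⟨_, h1⟩, _⟩
  · rw [length_simple, Nat.lt_one_iff, length_eq_zero_iff, mul_eq_one_iff_inv_eq,
      inv_simple] at h1
    exact hne (by rw [h1]; group)
  · have : v * cs.simple i * (cs.simple i * (u⁻¹ * v) * (cs.simple i)⁻¹) = u * cs.simple i := by
      conv_rhs => rw [← hvt]
      simp only [inv_simple, ← mul_assoc, simple_mul_simple_cancel_right]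
    rw [this] at h1
    omega

theorem isReflection_mul_simple {u v : W} (h : cs.IsReflection (u⁻¹ * v)) (i : B) :
    cs.IsReflection ((u * cs.simple i)⁻¹ * (v * cs.simple i)) := by
  have := h.conj (cs.simple i)
  simpa [mul_assoc] using this

theorem BruhatCovers.step {cs : CoxeterSystem A W} {u v : W} (h : cs.BruhatCovers u v) (i : B) :
    cs.BruhatLE (cs.upStep i u) (cs.upStep i v) ∧
      cs.BruhatLE (cs.downStep i u) (cs.downStep i v) := by
  by_cases hu : cs.IsRightDescent u i <;> by_cases hv : cs.IsRightDescent v i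
  · simp only [upStep, downStep, hu, hv, if_true]
    have := cs.isRightDescent_iff.1 hu
    have := cs.isRightDescent_iff.1 hv
    have := h.2
    exact ⟨h.le, BruhatCovers.le ⟨cs.isReflection_mul_simple h.1 i, by omega⟩⟩
  · simp only [upStep, downStep, hu, hv, if_true, if_false]
    exact ⟨h.le.trans (cs.bruhatCovers_mul_simple hv).le,
      (cs.mul_simple_bruhatCovers hu).le.trans h.le⟩
  · have := cs.mul_simple_eq_of_bruhatCovers h hu hv
    subst this
    simp only [upStep, downStep, hu, hv, if_true, if_false, simple_mul_simple_cancel_right]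
    exact ⟨cs.bruhatLE_refl _, cs.bruhatLE_refl _⟩
  · simp only [upStep, downStep, hu, hv, if_false]
    have := cs.not_isRightDescent_iff.1 hu
    have := cs.not_isRightDescent_iff.1 hv
    have := h.2
    exact ⟨BruhatCovers.le ⟨cs.isReflection_mul_simple h.1 i, by omega⟩, h.le⟩

/-- The lifting property of the Bruhat order, part one. -/
theorem BruhatLE.upStep {cs : CoxeterSystem A W} {u v : W} (h : cs.BruhatLE u v) (i : B) :
    cs.BruhatLE (cs.upStep i u) (cs.upStep i v) := by
  unfold BruhatLE at h
  induction h with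
  | refl => exact cs.bruhatLE_refl _
  | tail _ h ih => exact ih.trans (h.step i).1

/-- The lifting property of the Bruhat order, part two. -/
theorem BruhatLE.downStep {cs : CoxeterSystem A W} {u v : W} (h : cs.BruhatLE u v) (i : B) :
    cs.BruhatLE (cs.downStep i u) (cs.downStep i v) := by
  unfold BruhatLE at h
  induction h with
  | refl => exact cs.bruhatLE_refl _
  | tail _ h ih => exact ih.trans (h.step i).2

theorem exists_eq_mul_simple {y : W} (h : y ≠ 1) :
    ∃ z i, y = z * cs.simple i ∧ ¬ cs.IsRightDescent z i := by
  obtain ⟨i, hi⟩ := cs.exists_rightDescent_of_ne_one h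
  exact ⟨y * cs.simple i, i, by simp, cs.isRightDescent_iff_not_isRightDescent_mul.1 hi⟩

theorem downStep_mul_simple {z : W} {i : B} (h : ¬ cs.IsRightDescent z i) :
    cs.downStep i (z * cs.simple i) = z := by
  rw [downStep, if_pos, simple_mul_simple_cancel_right]
  rw [isRightDescent_iff_not_isRightDescent_mul, simple_mul_simple_cancel_right]
  exact h

/-- Length-additive products are monotone in both factors. -/
theorem mul_bruhatLE_mul {x y x' y' : W} (hxy : cs.length (x * y) = cs.length x + cs.length y)
    (hx : cs.BruhatLE x' x) (hy : cs.BruhatLE y' y) : cs.BruhatLE (x' * y') (x * y) := by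
  induction h : cs.length y generalizing y y' with
  | zero =>
    have h1 := cs.length_eq_zero_iff.1 h
    have h2 : y' = 1 := cs.length_eq_zero_iff.1 (by have := hy.length_le; omega)
    simpa [h1, h2] using hx
  | succ n ih =>
    have hne : y ≠ 1 := by rintro rfl; simp at h
    obtain ⟨z, i, rfl, hz⟩ := cs.exists_eq_mul_simple hne
    have hz' := cs.not_isRightDescent_iff.1 hz
    have h1 := cs.length_mul_le x z
    have h2 := cs.length_mul_le (x * z) (cs.simple i)
    rw [length_simple, mul_assoc] at h2
    have hd := hy.downStep i
    rw [cs.downStep_mul_simple hz] at hd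
    have key := ih (by omega) hd (by omega)
    have hni : ¬ cs.IsRightDescent (x * z) i := by
      rw [not_isRightDescent_iff, mul_assoc]; omega
    have hup := key.upStep i
    rw [upStep_of_not_descent cs hni, mul_assoc] at hup
    unfold CoxeterSystem.downStep at hup
    split_ifs at hup with hc
    · have := (cs.mul_simple_le_upStep i (x' * (y' * cs.simple i))).trans hup
      simpa [mul_assoc] using this
    · exact (cs.le_upStep i _).trans hup

/-- The subword property for length-additive products: an element below `x y` is itself a
length-additive product of an element below `x` and one below `y`. -/
theorem exists_eq_mul_of_bruhatLE_mul {x y u : W}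
    (hxy : cs.length (x * y) = cs.length x + cs.length y) (hu : cs.BruhatLE u (x * y)) :
    ∃ x' y', cs.BruhatLE x' x ∧ cs.BruhatLE y' y ∧ u = x' * y' ∧
      cs.length u = cs.length x' + cs.length y' := by
  induction h : cs.length y generalizing y u with
  | zero =>
    have h1 := cs.length_eq_zero_iff.1 h
    subst h1
    exact ⟨u, 1, by simpa using hu, cs.bruhatLE_refl 1, by simp, by simp⟩
  | succ n ih =>
    have hne : y ≠ 1 := by rintro rfl; simp at h
    obtain ⟨z, i, rfl, hz⟩ := cs.exists_eq_mul_simple hne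
    have hz' := cs.not_isRightDescent_iff.1 hz
    have h1 := cs.length_mul_le x z
    have h2 := cs.length_mul_le (x * z) (cs.simple i)
    rw [length_simple, mul_assoc] at h2
    have hni : ¬ cs.IsRightDescent (x * z) i := by
      rw [not_isRightDescent_iff, mul_assoc]; omega
    have hd := hu.downStep i
    rw [← mul_assoc, cs.downStep_mul_simple hni] at hd
    obtain ⟨x', y', hx', hy', he, hl⟩ := ih (by omega) hd (by omega)
    by_cases hc : cs.IsRightDescent u i
    · rw [downStep_of_descent cs hc] at he hl
      have he' : u = x' * (y' * cs.simple i) := by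
        rw [← mul_assoc, ← he, simple_mul_simple_cancel_right]
      have hu' := cs.isRightDescent_iff.1 hc
      have h3 := cs.length_mul_le x' (y' * cs.simple i)
      have h4 := cs.length_mul_simple y' i
      rw [← he'] at h3
      have hny : ¬ cs.IsRightDescent y' i := by rw [not_isRightDescent_iff]; omega
      have hup := hy'.upStep i
      rw [upStep_of_not_descent cs hny, upStep_of_not_descent cs hz] at hup
      exact ⟨x', y' * cs.simple i, hx', hup, he', by omega⟩
    · rw [downStep_of_not_descent cs hc] at he hl
      exact ⟨x', y', hx', hy'.trans (cs.bruhatCovers_mul_simple hz).le, he, hl⟩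

theorem le_mul_left_of_length {x y : W} (h : cs.length (x * y) = cs.length x + cs.length y) :
    cs.BruhatLE x (x * y) := by
  simpa using cs.mul_bruhatLE_mul h (cs.bruhatLE_refl x) (cs.one_bruhatLE y)

theorem le_mul_right_of_length {x y : W} (h : cs.length (x * y) = cs.length x + cs.length y) :
    cs.BruhatLE y (x * y) := by
  simpa using cs.mul_bruhatLE_mul h (cs.one_bruhatLE x) (cs.bruhatLE_refl y)

theorem upR_le (J : Set B) (w : W) : cs.BruhatLE (cs.upR J w) w := by
  have := cs.le_mul_left_of_length (cs.length_mul_of_mem_rightMin (cs.upR_mem J w)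
    (cs.downR_mem J w))
  rwa [upR_mul_downR] at this

theorem downR_le (J : Set B) (w : W) : cs.BruhatLE (cs.downR J w) w := by
  have := cs.le_mul_right_of_length (cs.length_mul_of_mem_rightMin (cs.upR_mem J w)
    (cs.downR_mem J w))
  rwa [upR_mul_downR] at this

theorem upL_le (J : Set B) (w : W) : cs.BruhatLE (cs.upL J w) w := by
  rw [← inv_bruhatLE_inv, ← upR_inv]; exact cs.upR_le J w⁻¹

theorem downL_le (J : Set B) (w : W) : cs.BruhatLE (cs.downL J w) w := by
  rw [← inv_bruhatLE_inv, ← downR_inv]; exact cs.downR_le J w⁻¹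

theorem BruhatLE.mem_parabolic {cs : CoxeterSystem A W} {J : Set B} {u v : W}
    (h : cs.BruhatLE u v) (hv : v ∈ cs.parabolic J) : u ∈ cs.parabolic J := by
  unfold BruhatLE at h
  induction h using Relation.ReflTransGen.head_induction_on with
  | refl => exact hv
  | @head a c h _ ih =>
    have hct : c * (a⁻¹ * c) = a := by rw [← h.1.inv]; group
    have hinv : cs.IsRightInversion c (a⁻¹ * c) := ⟨h.1, by rw [hct]; have := h.2; omega⟩
    rw [← hct]
    exact mul_mem ih (hinv.mem_parabolic ih)

theorem BruhatLE.upR {cs : CoxeterSystem A W} {u v : W} (h : cs.BruhatLE u v) (J : Set B) :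
    cs.BruhatLE (cs.upR J u) (cs.upR J v) := by
  have hadd := cs.length_mul_of_mem_rightMin (cs.upR_mem J v) (cs.downR_mem J v)
  rw [← cs.upR_mul_downR J v] at h
  obtain ⟨x, y, hx, hy, rfl, _⟩ := cs.exists_eq_mul_of_bruhatLE_mul hadd h
  have hyJ := hy.mem_parabolic (cs.downR_mem J v)
  have : cs.upR J (x * y) = cs.upR J x := by
    conv_lhs => rw [← cs.upR_mul_downR J x, mul_assoc]
    exact cs.upR_mul (cs.upR_mem J x) (mul_mem (cs.downR_mem J x) hyJ)
  rw [this]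
  exact (cs.upR_le J x).trans hx

theorem BruhatLE.upL {cs : CoxeterSystem A W} {u v : W} (h : cs.BruhatLE u v) (J : Set B) :
    cs.BruhatLE (cs.upL J u) (cs.upL J v) := by
  rw [← inv_bruhatLE_inv, ← upR_inv, ← upR_inv]
  exact h.inv.upR J

/-! ### Supports -/

theorem supp_mono {u v : W} (h : cs.BruhatLE u v) : cs.supp u ⊆ cs.supp v :=
  fun _ hi => BruhatLE.trans hi h

theorem suppIn_mono (H : Set B) {u v : W} (h : cs.BruhatLE u v) :
    cs.suppIn H u ⊆ cs.suppIn H v :=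
  Set.inter_subset_inter_left _ (cs.supp_mono h)

theorem supp_subset_of_mem_parabolic {J : Set B} {w : W} (h : w ∈ cs.parabolic J) :
    cs.supp w ⊆ J :=
  fun _ hi => cs.mem_of_simple_mem_parabolic (BruhatLE.mem_parabolic hi h)

theorem mem_parabolic_supp (w : W) : w ∈ cs.parabolic (cs.supp w) := by
  induction h : cs.length w generalizing w with
  | zero => rw [cs.length_eq_zero_iff.1 h]; exact one_mem _
  | succ n ih =>
    have hne : w ≠ 1 := by rintro rfl; simp at h
    obtain ⟨z, i, rfl, hz⟩ := cs.exists_eq_mul_simple hne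
    have hz' := cs.not_isRightDescent_iff.1 hz
    have h1 : cs.length (z * cs.simple i) = cs.length z + cs.length (cs.simple i) := by
      rw [hz', length_simple]
    exact mul_mem (cs.parabolic_mono (cs.supp_mono (cs.le_mul_left_of_length h1)) (ih z (by omega)))
      (cs.simple_mem_parabolic (cs.le_mul_right_of_length h1))

theorem mem_parabolic_iff {J : Set B} {w : W} : w ∈ cs.parabolic J ↔ cs.supp w ⊆ J :=
  ⟨cs.supp_subset_of_mem_parabolic, fun h => cs.parabolic_mono h (cs.mem_parabolic_supp w)⟩

theorem mem_parabolic_inter {J K : Set B} {w : W} (hJ : w ∈ cs.parabolic J)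
    (hK : w ∈ cs.parabolic K) : w ∈ cs.parabolic (J ∩ K) := by
  rw [mem_parabolic_iff] at *
  exact Set.subset_inter hJ hK

theorem supp_mul_subset (x y : W) : cs.supp (x * y) ⊆ cs.supp x ∪ cs.supp y := by
  rw [← mem_parabolic_iff]
  exact mul_mem (cs.parabolic_mono Set.subset_union_left (cs.mem_parabolic_supp x))
    (cs.parabolic_mono Set.subset_union_right (cs.mem_parabolic_supp y))

theorem mem_supp_of_isRightDescent {w : W} {i : B} (h : cs.IsRightDescent w i) : i ∈ cs.supp w :=
  cs.mem_of_isRightDescent (cs.mem_parabolic_supp w) h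

theorem supp_inv (w : W) : cs.supp w⁻¹ = cs.supp w := by
  ext i
  change cs.BruhatLE _ _ ↔ cs.BruhatLE _ _
  rw [← inv_bruhatLE, inv_simple]

theorem suppIn_inv (H : Set B) (w : W) : cs.suppIn H w⁻¹ = cs.suppIn H w := by
  rw [suppIn, suppIn, supp_inv]

theorem supp_simple (i : B) : cs.supp (cs.simple i) = {i} := by
  refine Set.Subset.antisymm (cs.supp_subset_of_mem_parabolic (cs.simple_mem_parabolic rfl)) ?_
  rintro _ rfl
  exact cs.bruhatLE_refl _

/-- The intersection `[e, w] ∩ W_H` has a largest element. -/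
theorem exists_greatest_parabolic (H : Set B) (w : W) :
    ∃ m, cs.BruhatLE m w ∧ m ∈ cs.parabolic H ∧
      ∀ y, cs.BruhatLE y w → y ∈ cs.parabolic H → cs.BruhatLE y m := by
  induction h : cs.length w generalizing w with
  | zero =>
    rw [cs.length_eq_zero_iff.1 h]
    exact ⟨1, cs.bruhatLE_refl 1, one_mem _, fun y hy _ => hy⟩
  | succ n ih =>
    have hne : w ≠ 1 := by rintro rfl; simp at h
    obtain ⟨z, i, rfl, hz⟩ := cs.exists_eq_mul_simple hne
    have hz' := cs.not_isRightDescent_iff.1 hz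
    obtain ⟨m, hm, hmH, hmax⟩ := ih z (by omega)
    have hzi := (cs.bruhatCovers_mul_simple hz).le
    by_cases hi : i ∈ H
    · have hiH := cs.simple_mem_parabolic hi
      refine ⟨cs.upStep i m, ?_, ?_, fun y hy hyH => ?_⟩
      · have := hm.upStep i
        rwa [upStep_of_not_descent cs hz] at this
      · unfold upStep
        split_ifs
        exacts [hmH, mul_mem hmH hiH]
      · have hd := hy.downStep i
        rw [cs.downStep_mul_simple hz] at hd
        have hle := (hmax _ hd ((cs.downStep_le i y).mem_parabolic hyH)).upStep i
        refine BruhatLE.trans ?_ hle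
        unfold downStep
        split_ifs
        · simpa using cs.mul_simple_le_upStep i (y * cs.simple i)
        · exact cs.le_upStep i y
    · refine ⟨m, hm.trans hzi, hmH, fun y hy hyH => hmax y ?_ hyH⟩
      have hd := hy.downStep i
      rwa [cs.downStep_mul_simple hz, downStep_of_not_descent] at hd
      exact fun hc => hi (cs.mem_of_isRightDescent hyH hc)

theorem longestBelow_le (H : Set B) (w : W) : cs.BruhatLE (cs.longestBelow H w) w :=
  (cs.exists_longest H w).choose_spec.1

theorem longestBelow_mem (H : Set B) (w : W) : cs.longestBelow H w ∈ cs.parabolic H :=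
  (cs.exists_longest H w).choose_spec.2.1

theorem le_longestBelow {H : Set B} {w y : W} (hy : cs.BruhatLE y w)
    (hyH : y ∈ cs.parabolic H) : cs.BruhatLE y (cs.longestBelow H w) := by
  obtain ⟨m, hm, hmH, hmax⟩ := cs.exists_greatest_parabolic H w
  have h1 := hmax _ (cs.longestBelow_le H w) (cs.longestBelow_mem H w)
  rw [h1.eq_of_length_le ((cs.exists_longest H w).choose_spec.2.2 m hm hmH)]
  exact hmax y hy hyH

theorem longestBelow_inv (H : Set B) (w : W) :
    cs.longestBelow H w⁻¹ = (cs.longestBelow H w)⁻¹ := by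
  have h1 : cs.BruhatLE (cs.longestBelow H w⁻¹) (cs.longestBelow H w)⁻¹ := by
    rw [← inv_bruhatLE]
    refine cs.le_longestBelow ?_ (inv_mem (cs.longestBelow_mem H _))
    rw [inv_bruhatLE]
    exact cs.longestBelow_le H _
  refine h1.eq_of_length_le (BruhatLE.length_le (cs.le_longestBelow ?_ ?_))
  · exact (cs.longestBelow_le H w).inv
  · exact inv_mem (cs.longestBelow_mem H w)

/-! ### Matchings of dihedral intervals -/

/-- The alternating product `s_i s_j s_i ⋯` with `k` factors. -/
def altProd (i j : B) : ℕ → W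
  | 0 => 1
  | k + 1 => cs.simple i * altProd j i k

theorem altProd_succ (i j : B) (k : ℕ) :
    cs.altProd i j (k + 1) = cs.simple i * cs.altProd j i k := rfl

theorem exists_altProd_succ_eq_mul (i j : B) (k : ℕ) :
    ∃ x, cs.altProd i j (k + 1) = cs.altProd i j k * cs.simple x := by
  induction k generalizing i j with
  | zero => exact ⟨i, by simp [altProd]⟩
  | succ k ih =>
    obtain ⟨x, hx⟩ := ih j i
    exact ⟨x, by rw [altProd_succ, hx, altProd_succ, mul_assoc]⟩

theorem length_altProd_le (i j : B) (k : ℕ) : cs.length (cs.altProd i j k) ≤ k := by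
  induction k generalizing i j with
  | zero => simp [altProd]
  | succ k ih =>
    have := cs.length_mul_le (cs.simple i) (cs.altProd j i k)
    have := ih j i
    rw [length_simple] at *
    rw [altProd_succ]
    omega

theorem eq_altProd_of_mem_parabolic {i j : B} {v : W} (hv : v ∈ cs.parabolic {i, j}) :
    v = cs.altProd i j (cs.length v) ∨ v = cs.altProd j i (cs.length v) := by
  induction h : cs.length v generalizing v with
  | zero => exact Or.inl (cs.length_eq_zero_iff.1 h)
  | succ n ih =>
    have hne : v ≠ 1 := by rintro rfl; simp at h
    obtain ⟨x, hx⟩ := cs.exists_leftDescent_of_ne_one hne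
    have hxm := cs.mem_of_isLeftDescent hv hx
    have hx' := cs.isLeftDescent_iff.1 hx
    -- a word for `s_x v` that starts with `x` again would be too short
    have key : ∀ y z, cs.simple x * v = cs.altProd y z n → y = x → n = 0 := by
      rintro y z he rfl
      by_contra hn
      obtain ⟨m, rfl⟩ := Nat.exists_eq_succ_of_ne_zero hn
      have h2 : v = cs.altProd z y m := by
        rw [Nat.succ_eq_add_one, altProd_succ] at he
        exact mul_left_cancel he
      have := cs.length_altProd_le z y m
      rw [← h2] at this
      omega
    have hv' : v = cs.simple x * (cs.simple x * v) := by simp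
    have ih' := ih (v := cs.simple x * v) (mul_mem (cs.simple_mem_parabolic hxm) hv) (by omega)
    rcases hxm with rfl | rfl <;> rcases ih' with he | he
    · left
      have := key _ _ he rfl
      subst this
      rw [hv', he]; rfl
    · left; rw [hv', he]; rfl
    · right; rw [hv', he]; rfl
    · right
      have := key _ _ he rfl
      subst this
      rw [hv', he]; rfl

theorem bruhatLE_of_mem_parabolic_pair_of_length_succ {i j : B} {u v : W}
    (hu : u ∈ cs.parabolic {i, j}) (hv : v ∈ cs.parabolic {i, j})
    (h : cs.length u + 1 = cs.length v) : cs.BruhatLE u v := by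
  have key : ∀ x y, v = cs.altProd x y (cs.length u + 1) →
      (u = cs.altProd x y (cs.length u) ∨ u = cs.altProd y x (cs.length u)) →
      cs.BruhatLE u v := by
    rintro x y hv (hu | hu)
    · obtain ⟨z, hz⟩ := cs.exists_altProd_succ_eq_mul x y (cs.length u)
      rw [hz, ← hu] at hv
      subst hv
      exact (cs.bruhatCovers_mul (cs.isReflection_simple z) h.symm).le
    · rw [altProd_succ, ← hu] at hv
      refine BruhatCovers.le ⟨⟨u⁻¹, x, ?_⟩, h⟩
      rw [hv, inv_inv, mul_assoc]
  rcases cs.eq_altProd_of_mem_parabolic hv with hv' | hv' <;> rw [← h] at hv'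
  · exact key _ _ hv' (cs.eq_altProd_of_mem_parabolic hu)
  · exact key _ _ hv' (cs.eq_altProd_of_mem_parabolic hu).symm

/-- In a parabolic subgroup of rank two the Bruhat order is determined by the length. -/
theorem bruhatLE_of_mem_parabolic_pair {i j : B} {u v : W}
    (hu : u ∈ cs.parabolic {i, j}) (hv : v ∈ cs.parabolic {i, j})
    (h : cs.length u < cs.length v) : cs.BruhatLE u v := by
  obtain ⟨n, hn⟩ := Nat.exists_eq_add_of_lt h
  induction n generalizing v with
  | zero => exact cs.bruhatLE_of_mem_parabolic_pair_of_length_succ hu hv (by omega)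
  | succ n ih =>
    have hne : v ≠ 1 := by rintro rfl; simp at h
    obtain ⟨x, hx⟩ := cs.exists_rightDescent_of_ne_one hne
    have hx' := cs.isRightDescent_iff.1 hx
    refine (ih (mul_mem hv (cs.simple_mem_parabolic (cs.mem_of_isRightDescent hv hx)))
      (by omega) (by omega)).trans (cs.mul_simple_bruhatCovers hx).le

theorem IsMatching.length {cs : CoxeterSystem A W} {x : W} {M : W → W} (hM : cs.IsMatching x M)
    {u : W} (hu : cs.BruhatLE u x) :
    cs.length (M u) = cs.length u + 1 ∨ cs.length (M u) + 1 = cs.length u := by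
  rcases (hM u hu).2.2 with h | h
  · exact Or.inl h.2.symm
  · exact Or.inr h.2

/-- On each level of a dihedral interval a matching goes up in at most one place: otherwise the
two elements of that level go up and so, by counting, the two elements of the level below both
go down, to two elements that both go up. -/
theorem IsMatching.eq_of_length_up {cs : CoxeterSystem A W} {i j : B} {x : W}
    (hx : x ∈ cs.parabolic {i, j}) {M : W → W} (hM : cs.IsMatching x M) {u v : W}
    (hu : cs.BruhatLE u x) (hv : cs.BruhatLE v x) (huv : cs.length u = cs.length v)
    (hMu : cs.length (M u) = cs.length u + 1) (hMv : cs.length (M v) = cs.length v + 1) :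
    u = v := by
  induction h : cs.length u using Nat.strong_induction_on generalizing u v with
  | _ n ih =>
    by_contra hne
    rcases n with _ | n
    · rw [huv] at hMu
      exact hne ((cs.length_eq_zero_iff.1 h).trans (cs.length_eq_zero_iff.1 (huv ▸ h)).symm)
    have hxl := (hM u hu).1.length_le
    have huH := hu.mem_parabolic hx
    have hvH := hv.mem_parabolic hx
    have eu := cs.eq_altProd_of_mem_parabolic huH
    have ev := cs.eq_altProd_of_mem_parabolic hvH
    rw [← huv, h] at ev
    rw [h] at eu
    -- the elements one level below `u` and `v` go down
    have down : ∀ y, y ∈ cs.parabolic {i, j} → cs.length y = n →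
        cs.BruhatLE y x ∧ cs.length (M y) + 1 = n := by
      intro y hy hyn
      have hyx : cs.BruhatLE y x := cs.bruhatLE_of_mem_parabolic_pair hy hx (by omega)
      refine ⟨hyx, ?_⟩
      rcases hM.length hyx with hl | hl
      · exfalso
        have hMy := hM y hyx
        have ey := cs.eq_altProd_of_mem_parabolic (hMy.1.mem_parabolic hx)
        rw [hl, hyn] at ey
        have : M y = u ∨ M y = v := by
          rcases eu with eu | eu <;> rcases ev with ev | ev <;> rcases ey with ey | ey <;>
            first
            | exact absurd (eu.trans ev.symm) hne
            | exact Or.inl (ey.trans eu.symm)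
            | exact Or.inr (ey.trans ev.symm)
        rcases this with h1 | h1 <;> have h2 := congrArg cs.length hMy.2.1 <;> rw [h1] at h2 <;>
          omega
      · omega
    have hn : n ≠ 0 := by
      rintro rfl
      have := (down 1 (one_mem _) (by simp)).2
      omega
    obtain ⟨m, rfl⟩ := Nat.exists_eq_succ_of_ne_zero hn
    -- there are two elements one level below `u` and `v`
    obtain ⟨y, z, hyz, hyH, hzH, hy, hz⟩ : ∃ y z, y ≠ z ∧ y ∈ cs.parabolic {i, j} ∧
        z ∈ cs.parabolic {i, j} ∧ cs.length y = m + 1 ∧ cs.length z = m + 1 := by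
      have main : ∀ a b, a ∈ ({i, j} : Set B) → b ∈ ({i, j} : Set B) →
          ∀ u v, u ∈ cs.parabolic {i, j} → v ∈ cs.parabolic {i, j} →
          cs.length u = m + 1 + 1 → cs.length v = m + 1 + 1 →
          u = cs.altProd a b (m + 1 + 1) → v = cs.altProd b a (m + 1 + 1) →
          ∃ y z, y ≠ z ∧ y ∈ cs.parabolic {i, j} ∧
            z ∈ cs.parabolic {i, j} ∧ cs.length y = m + 1 ∧ cs.length z = m + 1 := by
        intro a b ha hb u v hu hv hlu hlv eu ev
        have hy : cs.altProd b a (m + 1) = cs.simple a * u := by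
          rw [eu, altProd_succ cs a, simple_mul_simple_cancel_left]
        have hz : cs.altProd a b (m + 1) = cs.simple b * v := by
          rw [ev, altProd_succ cs b, simple_mul_simple_cancel_left]
        refine ⟨cs.simple a * u, cs.simple b * v, ?_, mul_mem (cs.simple_mem_parabolic ha) hu,
          mul_mem (cs.simple_mem_parabolic hb) hv, ?_, ?_⟩
        · intro heq
          have h1 : u = cs.altProd b a m := by
            rw [← hz, altProd_succ] at heq
            exact mul_left_cancel heq
          have := cs.length_altProd_le b a m
          rw [← h1] at this
          omega
        · have := cs.length_simple_mul u a
          have := cs.length_altProd_le b a (m + 1)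
          rw [hy] at this
          omega
        · have := cs.length_simple_mul v b
          have := cs.length_altProd_le a b (m + 1)
          rw [hz] at this
          omega
      rcases eu with eu | eu <;> rcases ev with ev | ev
      · exact absurd (eu.trans ev.symm) hne
      · exact main i j (by simp) (by simp) u v huH hvH h (huv ▸ h) eu ev
      · exact main j i (by simp) (by simp) u v huH hvH h (huv ▸ h) eu ev
      · exact absurd (eu.trans ev.symm) hne
    obtain ⟨hyx, hMy⟩ := down y hyH hy
    obtain ⟨hzx, hMz⟩ := down z hzH hz
    have hy2 := hM y hyx
    have hz2 := hM z hzx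
    have := ih m (by omega) hy2.1 hz2.1 (by omega) (by rw [hy2.2.1]; omega)
      (by rw [hz2.2.1]; omega) (by omega)
    apply hyz
    rw [← hy2.2.1, this, hz2.2.1]

/-- A matching of a dihedral interval that goes down at `b` restricts to `[e, b]`. -/
theorem IsMatching.le_of_le {cs : CoxeterSystem A W} {i j : B} {x : W}
    (hx : x ∈ cs.parabolic {i, j}) {M : W → W} (hM : cs.IsMatching x M) {b b' : W}
    (hb : cs.BruhatLE b x) (hMb : cs.length (M b) < cs.length b) (hb' : cs.BruhatLE b' b) :
    cs.BruhatLE (M b') b := by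
  have hlb : cs.length (M b) + 1 = cs.length b := by
    rcases hM.length hb with h | h <;> omega
  have hb'x := hb'.trans hb
  have hle := hb'.length_le
  have hbH := hb.mem_parabolic hx
  have hMbH := (hM b' hb'x).1.mem_parabolic hx
  rcases Nat.lt_or_ge (cs.length (M b')) (cs.length b) with h | h
  · exact cs.bruhatLE_of_mem_parabolic_pair hMbH hbH h
  rcases hM.length hb'x with h1 | h1
  · by_cases heq : cs.length b ≤ cs.length b'
    · have := hb'.eq_of_length_le heq
      subst this
      omega
    · have : b' = M b := hM.eq_of_length_up hx hb'x (hM b hb).1 (by omega) h1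
        (by rw [(hM b hb).2.1]; omega)
      rw [this, (hM b hb).2.1]
      exact cs.bruhatLE_refl b
  · omega

theorem IsMatching.exists_simple_eq {cs : CoxeterSystem A W} {H : Set B} {x : W}
    (hx : x ∈ cs.parabolic H) {M : W → W} (hM : cs.IsMatching x M) :
    ∃ s ∈ H, M 1 = cs.simple s := by
  have h1 := cs.one_bruhatLE x
  have hl : cs.length (M 1) = 1 := by
    rcases hM.length h1 with h | h <;> rw [length_one] at h <;> omega
  obtain ⟨s, hs⟩ := cs.length_eq_one_iff.1 hl
  exact ⟨s, cs.mem_of_simple_mem_parabolic (hs ▸ (hM 1 h1).1.mem_parabolic hx), hs⟩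

theorem eq_of_mem_parabolic_pair_of_commute {i j : B}
    (hc : cs.simple i * cs.simple j = cs.simple j * cs.simple i) {u : W}
    (hu : u ∈ cs.parabolic {i, j}) :
    u = 1 ∨ u = cs.simple i ∨ u = cs.simple j ∨ u = cs.simple i * cs.simple j := by
  induction hu using Subgroup.closure_induction_left with
  | one => simp
  | mul_left x hx y _ ih =>
    obtain ⟨k, hk | hk, rfl⟩ := hx <;> subst hk <;> rcases ih with rfl | rfl | rfl | rfl <;>
      simp [hc]
    simp [← hc]
  | inv_mul_cancel x hx y _ ih =>
    obtain ⟨k, hk | hk, rfl⟩ := hx <;> subst hk <;> rcases ih with rfl | rfl | rfl | rfl <;>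
      simp [hc]
    simp [← hc]

theorem IsMatching.isMultiplication_of_commute {cs : CoxeterSystem A W} {i j : B} (hij : i ≠ j)
    (hc : cs.simple i * cs.simple j = cs.simple j * cs.simple i) {x : W}
    (hx : x ∈ cs.parabolic {i, j}) {M : W → W} (hM : cs.IsMatching x M)
    (hi : M 1 = cs.simple i) : cs.IsMultiplication x M := by
  have hne : cs.simple i ≠ cs.simple j := fun h => hij (cs.simple_injective h)
  have hi1 : cs.simple i ≠ 1 := fun h => by simpa [h] using cs.length_simple i
  have hj1 : cs.simple j ≠ 1 := fun h => by simpa [h] using cs.length_simple j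
  have h1 := hM 1 (cs.one_bruhatLE x)
  have hMi : M (cs.simple i) = 1 := hi ▸ h1.2.1
  refine Or.inl ⟨i, fun u hu => ?_⟩
  have hMu := hM u hu
  have hself : M u ≠ u := fun h => by
    rcases hM.length hu with h' | h' <;> rw [h] at h' <;> omega
  rcases cs.eq_of_mem_parabolic_pair_of_commute hc (hu.mem_parabolic hx) with h | h | h | h <;>
    subst h
  · simpa using hi
  · simpa using hMi
  all_goals
    rcases cs.eq_of_mem_parabolic_pair_of_commute hc (hMu.1.mem_parabolic hx) with h | h | h | h <;>
      have h2 := hMu.2.1 <;> rw [h] at h2 ⊢ <;>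
      first
      | simp; done
      | simp_all

/-! ### Descents of products -/

theorem isRightInversion_simple_iff {i : B} {t : W} :
    cs.IsRightInversion (cs.simple i) t ↔ t = cs.simple i := by
  constructor
  · rintro ⟨_, h⟩
    rw [length_simple, Nat.lt_one_iff, length_eq_zero_iff, mul_eq_one_iff_inv_eq,
      inv_simple] at h
    exact h.symm
  · rintro rfl
    exact ⟨cs.isReflection_simple i, by simp⟩

theorem eq_of_mem_parabolic_singleton {i : B} {x : W} (hx : x ∈ cs.parabolic {i}) :
    x = 1 ∨ x = cs.simple i := by
  induction hx using Subgroup.closure_induction_left with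
  | one => simp
  | mul_left x hx y _ ih =>
    obtain ⟨k, rfl, rfl⟩ := hx
    rcases ih with rfl | rfl <;> simp
  | inv_mul_cancel x hx y _ ih =>
    obtain ⟨k, rfl, rfl⟩ := hx
    rcases ih with rfl | rfl <;> simp

theorem commute_of_mem_parabolic {H : Set B} {r : W}
    (hr : ∀ h ∈ H, r * cs.simple h = cs.simple h * r) {x : W} (hx : x ∈ cs.parabolic H) :
    r * x = x * r := by
  have : cs.parabolic H ≤ Subgroup.centralizer {r} := by
    rw [parabolic, Subgroup.closure_le]
    rintro _ ⟨h, hh, rfl⟩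
    simpa [Subgroup.mem_centralizer_iff] using hr h hh
  simpa [Subgroup.mem_centralizer_iff] using this hx

/-- If `s_r` commutes with an element `p` of a parabolic subgroup not containing `s_r`, then it
commutes with the right descents of `p`: the `{r, h}`-part of `p s_r` is `s_h s_r` with `s_h` as a
right descent. -/
theorem commute_of_isRightDescent {H : Set B} {r h : B} (hr : r ∉ H) {p : W}
    (hp : p ∈ cs.parabolic H) (hc : cs.simple r * p = p * cs.simple r)
    (hh : cs.IsRightDescent p h) : cs.simple r * cs.simple h = cs.simple h * cs.simple r := by
  have hhH : h ∈ H := cs.mem_of_isRightDescent hp hh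
  have hhr : h ≠ r := fun e => hr (e ▸ hhH)
  have hpr : ¬ cs.IsRightDescent p r := fun hd => hr (cs.mem_of_isRightDescent hp hd)
  have hpr' := cs.not_isRightDescent_iff.1 hpr
  have hph' := cs.isRightDescent_iff.1 hh
  set x := p * cs.simple r with hx
  set I : Set B := {r, h} with hI
  have hxh : cs.length (x * cs.simple h) < cs.length x := by
    rw [← hc, mul_assoc]
    have := cs.length_mul_le (cs.simple r) (p * cs.simple h)
    rw [length_simple] at this
    rw [hc]
    omega
  have hadd : ∀ i ∈ I, cs.length (x * cs.simple i) =
      cs.length (cs.upR I x) + cs.length (cs.downR I x * cs.simple i) := by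
    intro i hi
    conv_lhs => rw [← cs.upR_mul_downR I x, mul_assoc]
    exact cs.length_mul_of_mem_rightMin (cs.upR_mem I x)
      (mul_mem (cs.downR_mem I x) (cs.simple_mem_parabolic hi))
  have hx0 := cs.length_upR_add I x
  have hyh : cs.IsRightDescent (cs.downR I x) h := by
    have := hadd h (by simp [hI])
    unfold IsRightDescent
    omega
  have hy : cs.downR I x * cs.simple r ∈ cs.parabolic {h} := by
    have hI' : cs.downR I x * cs.simple r ∈ cs.parabolic I :=
      mul_mem (cs.downR_mem I x) (cs.simple_mem_parabolic (by simp [hI]))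
    have hle : cs.BruhatLE (cs.downR I x * cs.simple r) p := by
      have e : cs.upR I x * (cs.downR I x * cs.simple r) = p := by
        rw [← mul_assoc, cs.upR_mul_downR, hx, simple_mul_simple_cancel_right]
      conv_rhs => rw [← e]
      exact cs.le_mul_right_of_length (cs.length_mul_of_mem_rightMin (cs.upR_mem I x) hI')
    refine cs.parabolic_mono ?_ (cs.mem_parabolic_inter hI' (hle.mem_parabolic hp))
    rintro k ⟨hk | hk, hkH⟩
    · exact absurd (hk ▸ hkH) hr
    · exact hk
  have hsing : ¬ cs.IsRightInversion (cs.simple r) (cs.simple h) := by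
    rw [isRightInversion_simple_iff]
    exact fun e => hhr (cs.simple_injective e)
  rw [← isRightInversion_simple_iff_isRightDescent] at hyh
  rcases cs.eq_of_mem_parabolic_singleton hy with e | e
  · rw [mul_eq_one_iff_eq_inv, inv_simple] at e
    rw [e] at hyh
    exact absurd hyh hsing
  · rw [← eq_mul_inv_iff_mul_eq, inv_simple] at e
    rw [e, cs.isRightInversion_mul_iff (cs.isReflection_simple h)] at hyh
    rcases hyh with ⟨h1, _⟩ | ⟨h1, _⟩
    · exact absurd h1 hsing
    · rw [isRightInversion_simple_iff, mul_inv_eq_iff_eq_mul] at h1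
      exact h1

/-- Deodhar's lemma: if `x` has no left descents in `L` and `x s_r` has one, then
`s_l x = x s_r` for some `l ∈ L`. -/
theorem exists_simple_mul_eq_mul_simple {L : Set B} {x : W} {r : B} (hx : x ∈ cs.leftMin L)
    (hxr : x * cs.simple r ∉ cs.leftMin L) :
    ∃ l ∈ L, cs.simple l * x = x * cs.simple r := by
  simp only [leftMin, Set.mem_ofPred_eq, not_forall, not_not] at hxr
  obtain ⟨l, hl, hd⟩ := hxr
  refine ⟨l, hl, ?_⟩
  rw [← isRightDescent_inv_iff, ← isRightInversion_simple_iff_isRightDescent, mul_inv_rev,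
    inv_simple, cs.isRightInversion_mul_iff (cs.isReflection_simple l)] at hd
  rcases hd with ⟨h, _⟩ | ⟨h, _⟩
  · rw [isRightInversion_simple_iff_isRightDescent, isRightDescent_inv_iff] at h
    exact absurd h (hx l hl)
  · rw [isRightInversion_simple_iff, inv_inv, mul_assoc, inv_mul_eq_iff_eq_mul] at h
    exact h

/-- A conjugate `p s_r p⁻¹`, with `p ∈ W_H` and `r ∉ H`, lies in `W_L` only for the obvious
reasons: if `l` is the `W_L`-part of `p = l p'`, then `s_r` commutes with `p'`. -/
theorem commute_upL_of_conj_mem_parabolic {H L : Set B} {p : W} {r : B}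
    (hp : p ∈ cs.parabolic H) (hr : r ∉ H)
    (h : p * cs.simple r * p⁻¹ ∈ cs.parabolic L) :
    cs.simple r * cs.upL L p = cs.upL L p * cs.simple r := by
  set p' := cs.upL L p with hp'
  set l := cs.downL L p with hl
  have hlp : l * p' = p := cs.downL_mul_upL L p
  have hlL : l ∈ cs.parabolic L := cs.downL_mem L p
  have hp'L : p' ∈ cs.leftMin L := cs.upL_mem L p
  have hp'H : p' ∈ cs.parabolic H := (cs.upL_le L p).mem_parabolic hp
  have hy : p' * cs.simple r * p'⁻¹ ∈ cs.parabolic L := by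
    have := mul_mem (mul_mem (inv_mem hlL) h) hlL
    rw [← hlp] at this
    simpa [mul_assoc] using this
  have hpr : p' * cs.simple r ∉ cs.leftMin L := by
    intro hmin
    have h1 := cs.upL_mul hmin (one_mem _)
    rw [one_mul] at h1
    have h2 := cs.upL_mul hp'L hy
    rw [inv_mul_cancel_right, h1] at h2
    exact cs.length_mul_simple_ne p' r (congrArg cs.length h2)
  obtain ⟨k, hk, he⟩ := cs.exists_simple_mul_eq_mul_simple hp'L hpr
  have hr' : r ∉ cs.supp p' := fun h => hr (cs.supp_subset_of_mem_parabolic hp'H h)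
  have hrd : cs.IsRightDescent (p' * cs.simple r) r := by
    rw [isRightDescent_iff_not_isRightDescent_mul, simple_mul_simple_cancel_right]
    exact fun hd => hr' (cs.mem_supp_of_isRightDescent hd)
  have hmem := cs.supp_mul_subset _ _ (he.symm ▸ cs.mem_supp_of_isRightDescent hrd)
  rw [supp_simple] at hmem
  rcases hmem with rfl | hmem
  · exact he
  · exact absurd hmem hr'

/-- A right descent `r ∉ H` of `a p`, with `p ∈ W_H`, makes `p s_r p⁻¹` an inversion of `a`, so
that `commute_upL_of_conj_mem_parabolic` applies to the support `L` of `a`. If the factor `p'` of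
`p = l p'` is not trivial, it has a right descent, which is not `s` and so must be `t`. -/
theorem commute_or_mem_of_isRightDescent_mul {H : Set B} {s t r : B} (hH : H = {s, t})
    (hrs : cs.simple r * cs.simple s = cs.simple s * cs.simple r) {a p : W}
    (hp : p ∈ cs.parabolic H) (hps : ¬ cs.IsRightDescent p s) (hr : r ∉ H)
    (hd : cs.IsRightDescent (a * p) r) :
    (∀ h ∈ H, cs.simple r * cs.simple h = cs.simple h * cs.simple r) ∨
      p ∈ cs.parabolic (cs.suppIn H a) := by
  have hρ : p * cs.simple r * p⁻¹ ∈ cs.parabolic (cs.supp a) := by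
    rw [← isRightInversion_simple_iff_isRightDescent,
      cs.isRightInversion_mul_iff (cs.isReflection_simple r)] at hd
    rcases hd with ⟨h, _⟩ | ⟨h, _⟩
    · rw [isRightInversion_simple_iff_isRightDescent] at h
      exact absurd (cs.mem_of_isRightDescent hp h) hr
    · exact h.mem_parabolic (cs.mem_parabolic_supp a)
  have hc := cs.commute_upL_of_conj_mem_parabolic hp hr hρ
  have hp'H := (cs.upL_le (cs.supp a) p).mem_parabolic hp
  have hlp := cs.downL_mul_upL (cs.supp a) p
  by_cases h1 : cs.upL (cs.supp a) p = 1
  · right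
    rw [h1, mul_one] at hlp
    exact cs.mem_parabolic_inter (hlp ▸ cs.downL_mem (cs.supp a) p) hp
  · left
    obtain ⟨h, hh⟩ := cs.exists_rightDescent_of_ne_one h1
    have hcomm := cs.commute_of_isRightDescent hr hp'H hc hh
    have hph : cs.IsRightDescent p h := by
      have h2 := cs.length_mul_le (cs.downL (cs.supp a) p)
        (cs.upL (cs.supp a) p * cs.simple h)
      rw [← mul_assoc, hlp] at h2
      have h3 := cs.length_downL_add (cs.supp a) p
      unfold IsRightDescent at hh ⊢
      omega
    have hhH := cs.mem_of_isRightDescent hp hph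
    rw [hH] at hhH ⊢
    rcases hhH with rfl | rfl
    · exact absurd hph hps
    · rintro k (rfl | rfl)
      exacts [hrs, hcomm]

theorem CommutesLeft.mul {cs : CoxeterSystem A W} {I : Set B} {x₀ : W} {M : W → W}
    (h : ∀ i ∈ I, cs.CommutesLeft x₀ M i) {x y : W} (hx : x ∈ cs.parabolic I)
    (hy : cs.BruhatLE y x₀) : cs.BruhatLE (x * y) x₀ ∧ M (x * y) = x * M y := by
  induction hx using Subgroup.closure_induction_left with
  | one => simpa using hy
  | mul_left x hx z _ ih =>
    obtain ⟨k, hk, rfl⟩ := hx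
    have := h k hk _ ih.1
    rw [mul_assoc, mul_assoc, this.2, ih.2]
    exact ⟨this.1, rfl⟩
  | inv_mul_cancel x hx z _ ih =>
    obtain ⟨k, hk, rfl⟩ := hx
    have := h k hk _ ih.1
    rw [inv_simple, mul_assoc, mul_assoc, this.2, ih.2]
    exact ⟨this.1, rfl⟩

theorem CommutesRight.mul {cs : CoxeterSystem A W} {I : Set B} {x₀ : W} {M : W → W}
    (h : ∀ i ∈ I, cs.CommutesRight x₀ M i) {x y : W} (hx : x ∈ cs.parabolic I)
    (hy : cs.BruhatLE y x₀) : cs.BruhatLE (y * x) x₀ ∧ M (y * x) = M y * x := by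
  induction hx using Subgroup.closure_induction_right with
  | one => simpa using hy
  | mul_right z _ x hx ih =>
    obtain ⟨k, hk, rfl⟩ := hx
    have := h k hk _ ih.1
    rw [← mul_assoc, ← mul_assoc, this.2, ih.2]
    exact ⟨this.1, rfl⟩
  | mul_inv_cancel z _ x hx ih =>
    obtain ⟨k, hk, rfl⟩ := hx
    have := h k hk _ ih.1
    rw [inv_simple, ← mul_assoc, ← mul_assoc, this.2, ih.2]
    exact ⟨this.1, rfl⟩

/-! ### Systems with `H ⊆ K` -/

/-- A system `(J, H, M)` for `w` with `M(e) = s` and `H ⊆ K = (S \ J) ∪ C_s`. By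
`IsSystem.right_or_left` every system or its image under inversion is of this form. The case
`|H| = 1` is included as `s = t`. -/
structure IsRightSystem (w : W) (J H : Set B) (M : W → W) (s t : B) : Prop
    extends cs.IsSystem w J H M where
  map_one : M 1 = cs.simple s
  eq_pair : H = {s, t}
  subset : H ⊆ cs.complement (M 1) J
  eq_of_mem_inter : ∀ i ∈ H, i ∈ J → i = s

theorem mem_commGens_of_mem {x : W} {J : Set B} {i : B} (hJ : i ∈ J)
    (hK : i ∈ cs.complement x J) : i ∈ cs.commGens x :=
  hK.resolve_left (fun h => h hJ)

theorem upR_mem_parabolic_of_le {J K : Set B} {u w : W} (hw : cs.upR J w ∈ cs.parabolic K)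
    (hu : cs.BruhatLE u w) : cs.upR J u ∈ cs.parabolic K :=
  (hu.upR J).mem_parabolic hw

namespace IsRightSystem

variable {cs} {w : W} {J H : Set B} {M : W → W} {s t : B}

section

variable (hS : cs.IsRightSystem w J H M s t)
include hS

theorem s_mem_H : s ∈ H := by rw [hS.eq_pair]; simp

theorem s_mem_J : s ∈ J :=
  hS.commGens_subset (by simp [commGens, hS.map_one])

theorem simple_commute {i : B} (hi : i ∈ cs.commGens (M 1)) :
    cs.simple i * cs.simple s = cs.simple s * cs.simple i := by
  have : M 1 * cs.simple i = cs.simple i * M 1 := hi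
  rw [hS.map_one] at this
  exact this.symm

theorem s_le : cs.BruhatLE (cs.simple s) (cs.longestBelow H w) :=
  hS.map_one ▸ (hS.matching 1 (cs.one_bruhatLE _)).1

theorem map_s : M (cs.simple s) = 1 := hS.map_one ▸ (hS.matching 1 (cs.one_bruhatLE _)).2.1

theorem map_of_mem_singleton {q : W} (hq : q ∈ cs.parabolic {s}) :
    cs.BruhatLE q (cs.longestBelow H w) ∧ M q = cs.simple s * q := by
  rcases cs.eq_of_mem_parabolic_singleton hq with rfl | rfl
  · exact ⟨cs.one_bruhatLE _, by simp [hS.map_one]⟩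
  · exact ⟨hS.s_le, by simp [hS.map_s]⟩

/-- An element of `W_{supp_H(a)}` can be pulled out of `M`. -/
theorem map_mul_of_mem_suppIn {a p q : W}
    (ha : ∀ i ∈ cs.suppIn H a, cs.CommutesLeft (cs.longestBelow H w) M i)
    (hp : p ∈ cs.parabolic (cs.suppIn H a)) (hq : q ∈ cs.parabolic {s}) :
    M (p * q) = p * cs.simple s * q := by
  obtain ⟨h1, h2⟩ := hS.map_of_mem_singleton hq
  rw [(CommutesLeft.mul ha hp h1).2, h2, mul_assoc]

theorem singleton_le_H : cs.parabolic {s} ≤ cs.parabolic H :=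
  cs.parabolic_mono (Set.singleton_subset_iff.2 hS.s_mem_H)

theorem singleton_le_J : cs.parabolic {s} ≤ cs.parabolic J :=
  cs.parabolic_mono (Set.singleton_subset_iff.2 hS.s_mem_J)

/-- The descents in `J` of a product `a p` with `a ∈ W_K ∩ W^H` and `p ∈ W_H`, `p < p s`. -/
theorem descent_mul {a p : W} {i : B} (haK : a ∈ cs.parabolic (cs.complement (M 1) J))
    (haH : a ∈ cs.rightMin H) (hp : p ∈ cs.parabolic H) (hps : p ∈ cs.rightMin {s})
    (hi : i ∈ J) (hd : cs.IsRightDescent (a * p) i) :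
    i ∉ H ∧ i ∈ cs.commGens (M 1) ∧
      ((∀ h ∈ H, cs.simple i * cs.simple h = cs.simple h * cs.simple i) ∨
        p ∈ cs.parabolic (cs.suppIn H a)) := by
  have hiH : i ∉ H := by
    intro hiH
    have := hS.eq_of_mem_inter i hiH hi
    subst this
    have h1 := cs.length_mul_of_mem_rightMin haH hp
    have h2 := cs.length_mul_of_mem_rightMin haH (mul_mem hp (cs.simple_mem_parabolic hiH))
    have h3 := hps i rfl
    rw [← mul_assoc] at h2
    unfold IsRightDescent at h3 hd
    omega
  have hiK : i ∈ cs.complement (M 1) J :=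
    cs.mem_of_isRightDescent (mul_mem haK (cs.parabolic_mono hS.subset hp)) hd
  have hiC := cs.mem_commGens_of_mem hi hiK
  exact ⟨hiH, hiC, cs.commute_or_mem_of_isRightDescent_mul hS.eq_pair (hS.simple_commute hiC) hp
    (hps s rfl) hiH hd⟩

/-- If `s` lies below an element `k` of `W_{C_s}`, it is a left descent of `k`, because it is
central in `W_{C_s}`. -/
theorem isLeftDescent_of_mem_supp {k : W} (hk : k ∈ cs.parabolic (cs.commGens (M 1)))
    (hs : s ∈ cs.supp k) : cs.IsLeftDescent k s := by
  induction h : cs.length k generalizing k with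
  | zero =>
    rw [cs.length_eq_zero_iff.1 h] at hs
    have := BruhatLE.length_le hs
    simp at this
  | succ n ih =>
    have hne : k ≠ 1 := by rintro rfl; simp at h
    obtain ⟨z, i, rfl, hz⟩ := cs.exists_eq_mul_simple hne
    have hz' := cs.not_isRightDescent_iff.1 hz
    have hzi := (cs.bruhatCovers_mul_simple hz).le
    have hzC := hzi.mem_parabolic hk
    have hscomm := cs.commute_of_mem_parabolic (fun h hh => (hS.simple_commute hh).symm) hk
    by_cases hzs : s ∈ cs.supp z
    · have := ih hzC hzs (by omega)
      have h2 := cs.length_mul_le (cs.simple s * z) (cs.simple i)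
      rw [length_simple] at h2
      unfold IsLeftDescent at this ⊢
      rw [← mul_assoc]
      omega
    · rcases cs.supp_mul_subset _ _ hs with h1 | h1
      · exact absurd h1 hzs
      · rw [supp_simple, Set.mem_singleton_iff] at h1
        subst h1
        rw [IsLeftDescent, hscomm, simple_mul_simple_cancel_right]
        omega

/-- The conditions on the right factor of the canonical factorization. Since `H ∩ J ⊆ {s}` only
`s` can lie below `c`, and then, by `isLeftDescent_of_mem_supp`, below `^K c`. -/
theorem right_conditions {c : W} (hc : cs.BruhatLE c w) (hcJ : c ∈ cs.parabolic J)
    (hcH : c ∈ cs.leftMin H) :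
    (cs.suppIn H c).encard ≤ 1 ∧
      ∀ i ∈ cs.suppIn H c, cs.CommutesRight (cs.longestBelow H w) M i := by
  have hsub : ∀ i ∈ cs.suppIn H c, i = s := fun i hi =>
    hS.eq_of_mem_inter i hi.2 (cs.supp_subset_of_mem_parabolic hcJ hi.1)
  refine ⟨?_, fun i hi => ?_⟩
  · rw [Set.encard_le_one_iff]
    intro i j hi hj
    rw [hsub i hi, hsub j hj]
  · have := hsub i hi
    subst this
    apply hS.s2_right
    set K := cs.complement (M 1) J with hK
    have hk : cs.downL K c ∈ cs.parabolic (cs.commGens (M 1)) := by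
      refine cs.parabolic_mono ?_ (cs.mem_parabolic_inter
        ((cs.downL_le K c).mem_parabolic hcJ) (cs.downL_mem K c))
      rintro j ⟨hj, hjK⟩
      exact cs.mem_commGens_of_mem hj hjK
    have hupH : cs.upL K c ∈ cs.leftMin H := fun j hj => cs.upL_mem K c j (hS.subset hj)
    have hle : cs.BruhatLE (cs.upL K c) (cs.upL H (cs.upL K w)) := by
      have h1 := (hc.upL K).upL H
      have h2 := cs.upL_mul hupH (one_mem _)
      rw [one_mul] at h2
      rwa [h2] at h1
    refine cs.suppIn_mono H hle ⟨?_, hi.2⟩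
    have h3 := hi.1
    rw [← cs.downL_mul_upL K c] at h3
    refine (cs.supp_mul_subset _ _ h3).resolve_left fun h4 => ?_
    have h5 := hS.isLeftDescent_of_mem_supp hk h4
    refine hcH i hi.2 ?_
    have h6 := cs.length_mul_le (cs.simple i * cs.downL K c) (cs.upL K c)
    rw [mul_assoc, cs.downL_mul_upL] at h6
    have h7 := cs.length_downL_add K c
    unfold IsLeftDescent at h5 ⊢
    omega

theorem downL_downR_mem (u : W) : cs.downL H (cs.downR J u) ∈ cs.parabolic {s} := by
  refine cs.parabolic_mono ?_ (cs.mem_parabolic_inter (cs.downL_mem H (cs.downR J u))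
    ((cs.downL_le H (cs.downR J u)).mem_parabolic (cs.downR_mem J u)))
  rintro i ⟨hi, hi'⟩
  exact hS.eq_of_mem_inter i hi hi'

theorem downR_upR_mem (u : W) : cs.downR H (cs.upR J u) ∈ cs.rightMin {s} := by
  intro i hi hd
  rw [show i = s from hi] at hd
  refine cs.upR_mem J u s hS.s_mem_J ?_
  have h1 := cs.length_mul_le (cs.upR H (cs.upR J u)) (cs.downR H (cs.upR J u) * cs.simple s)
  rw [← mul_assoc, upR_mul_downR] at h1
  have h2 := cs.length_upR_add H (cs.upR J u)
  unfold IsRightDescent at hd ⊢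
  omega

/-- Length additivity of `a z c` when the left part of `z` keeps `a` minimal. -/
theorem length_mul_mul {a z c : W} (haH : a ∈ cs.rightMin H) (hz : z ∈ cs.parabolic H)
    (hcJ : c ∈ cs.parabolic J) (hcH : c ∈ cs.leftMin H)
    (haz : a * cs.upR {s} z ∈ cs.rightMin J) :
    cs.length (a * z * c) = cs.length a + cs.length z + cs.length c := by
  have hqs := cs.downR_mem {s} z
  have e : a * z * c = a * cs.upR {s} z * (cs.downR {s} z * c) := by
    conv_lhs => rw [← cs.upR_mul_downR {s} z]
    simp only [mul_assoc]
  rw [e, cs.length_mul_of_mem_rightMin haz (mul_mem (hS.singleton_le_J hqs) hcJ),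
    cs.length_mul_of_mem_rightMin haH ((cs.upR_le {s} z).mem_parabolic hz),
    cs.length_mul_of_mem_leftMin hcH (hS.singleton_le_H hqs), ← cs.length_upR_add {s} z]
  omega

end

/-- The canonical factorization
`u = (u^J)^H · ((u^J)_H · _H(u_J)) · ^H(u_J)`. -/
theorem isFactorization_canonical (hS : cs.IsRightSystem w J H M s t) {u : W}
    (hu : cs.BruhatLE u w) :
    cs.IsFactorization w J H M u (cs.upR H (cs.upR J u))
      (cs.downR H (cs.upR J u) * cs.downL H (cs.downR J u)) (cs.upL H (cs.downR J u)) := by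
  have hq := hS.downL_downR_mem u
  have hc := (cs.upL_le H (cs.downR J u)).mem_parabolic (cs.downR_mem J u)
  have hcw := ((cs.upL_le H (cs.downR J u)).trans (cs.downR_le J u)).trans hu
  have hR := hS.right_conditions hcw hc (cs.upL_mem H _)
  have hsupp := cs.suppIn_mono H ((hu.upR J).upR H)
  have hbH := mul_mem (cs.downR_mem H (cs.upR J u)) (cs.downL_mem H (cs.downR J u))
  have haK := (cs.upR_le H (cs.upR J u)).mem_parabolic (cs.upR_mem_parabolic_of_le hS.s1 hu)
  have e : cs.upR H (cs.upR J u) * (cs.downR H (cs.upR J u) * cs.downL H (cs.downR J u)) *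
      cs.upL H (cs.downR J u) = u := by
    rw [← mul_assoc, cs.upR_mul_downR, mul_assoc, cs.downL_mul_upL, cs.upR_mul_downR]
  refine ⟨e.symm, ?_, haK, cs.upR_mem H _, (Set.encard_le_encard hsupp).trans hS.s2_left_card,
    fun i hi => hS.s2_left i (hsupp hi), hbH, hc, cs.upL_mem H _, hR.1, hR.2⟩
  conv_lhs => rw [← e]
  refine hS.length_mul_mul (cs.upR_mem H _) hbH hc (cs.upL_mem H _) ?_
  rw [cs.upR_mul (hS.downR_upR_mem u) hq, upR_mul_downR]
  exact cs.upR_mem J u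

theorem mid_le {u a b c : W} (hf : cs.IsFactorization w J H M u a b c) (hu : cs.BruhatLE u w) :
    cs.BruhatLE b (cs.longestBelow H w) := by
  refine cs.le_longestBelow (BruhatLE.trans ?_ hu) hf.mid_parabolic
  have h1 := hf.length_eq
  have h2 := cs.length_mul_le a b
  have h3 := cs.length_mul_le (a * b) c
  rw [hf.eq_mul] at *
  exact (cs.le_mul_right_of_length (by omega)).trans (cs.le_mul_left_of_length (by omega))

/-- Replacing `b` by `M(b)` in the canonical factorization keeps it length-additive. -/
theorem isFactorization_map_canonical (hS : cs.IsRightSystem w J H M s t) {u : W}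
    (hu : cs.BruhatLE u w) {a b c : W} (ha : a = cs.upR H (cs.upR J u))
    (hb : b = cs.downR H (cs.upR J u) * cs.downL H (cs.downR J u))
    (hc : c = cs.upL H (cs.downR J u)) :
    cs.IsFactorization w J H M (a * M b * c) a (M b) c := by
  have hf : cs.IsFactorization w J H M u a b c := by
    rw [ha, hb, hc]; exact hS.isFactorization_canonical hu
  have hbw := mid_le hf hu
  have hMb := hS.matching b hbw
  have hMbH := hMb.1.mem_parabolic (cs.longestBelow_mem H w)
  refine ⟨rfl, ?_, hf.left_parabolic, hf.left_min, hf.left_card, hf.left_comm, hMbH,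
    hf.right_parabolic, hf.right_min, hf.right_card, hf.right_comm⟩
  refine hS.length_mul_mul hf.left_min hMbH hf.right_parabolic hf.right_min ?_
  set p := cs.downR H (cs.upR J u) with hp
  set q := cs.downL H (cs.downR J u) with hq
  have hpH : p ∈ cs.parabolic H := cs.downR_mem H _
  have hps : p ∈ cs.rightMin {s} := hS.downR_upR_mem u
  have hqs : q ∈ cs.parabolic {s} := hS.downL_downR_mem u
  have hap : a * p = cs.upR J u := by rw [ha, hp, cs.upR_mul_downR]
  have hapJ : a * p ∈ cs.rightMin J := hap ▸ cs.upR_mem J u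
  set p' := cs.upR {s} (M b) with hp'
  have hp'H : p' ∈ cs.parabolic H := (cs.upR_le {s} (M b)).mem_parabolic hMbH
  have hp's : p' ∈ cs.rightMin {s} := cs.upR_mem {s} (M b)
  have hq's : cs.downR {s} (M b) ∈ cs.parabolic {s} := cs.downR_mem {s} (M b)
  intro i hi hd
  obtain ⟨hiH, -, h | h⟩ := hS.descent_mul hf.left_parabolic hf.left_min hp'H hp's hi hd
  · refine hapJ i hi ?_
    have conj : ∀ x ∈ cs.parabolic H, x * cs.simple i * x⁻¹ = cs.simple i := by
      intro x hx
      rw [← cs.commute_of_mem_parabolic h hx, mul_inv_cancel_right]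
    have hni : ∀ x ∈ cs.parabolic H, ¬ cs.IsRightInversion x (cs.simple i) := by
      intro x hx hx'
      rw [isRightInversion_simple_iff_isRightDescent] at hx'
      exact hiH (cs.mem_of_isRightDescent hx hx')
    rw [← isRightInversion_simple_iff_isRightDescent,
      cs.isRightInversion_mul_iff (cs.isReflection_simple i), conj _ hp'H] at hd
    rw [← isRightInversion_simple_iff_isRightDescent,
      cs.isRightInversion_mul_iff (cs.isReflection_simple i), conj _ hpH]
    rcases hd with ⟨h1, _⟩ | ⟨h1, _⟩
    · exact absurd h1 (hni _ hp'H)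
    · exact Or.inr ⟨h1, hni _ hpH⟩
  · have h1 := hS.map_mul_of_mem_suppIn hf.left_comm h hq's
    rw [cs.upR_mul_downR, hMb.2.1, mul_assoc] at h1
    have h2 := (cs.eq_of_mul_eq_mul_of_mem_rightMin hps hp's hqs
      (mul_mem (cs.simple_mem_parabolic rfl) hq's) (hb.symm.trans h1)).1
    exact hapJ i hi (h2 ▸ hd)

/-- The value `a M(b) c` does not depend on the factorization: it agrees with the one of the
canonical factorization. A factorization which is not canonical has a generator commuting with
`W_H` which can be moved from `a` to `c`, or its value is `u^J s u_J`. -/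
theorem mul_map_mul_eq (hS : cs.IsRightSystem w J H M s t) {u : W}
    (hu : cs.BruhatLE u w) {a b c : W} (hf : cs.IsFactorization w J H M u a b c) :
    a * M b * c = cs.upR H (cs.upR J u) *
      M (cs.downR H (cs.upR J u) * cs.downL H (cs.downR J u)) * cs.upL H (cs.downR J u) := by
  induction h : cs.length a using Nat.strong_induction_on generalizing a c with
  | _ n ih =>
  have hbw := mid_le hf hu
  set p := cs.upR {s} b with hp
  set q := cs.downR {s} b with hq
  have hpq : p * q = b := cs.upR_mul_downR {s} b
  have hpH : p ∈ cs.parabolic H := (cs.upR_le {s} b).mem_parabolic hf.mid_parabolic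
  have hps : p ∈ cs.rightMin {s} := cs.upR_mem {s} b
  have hqs : q ∈ cs.parabolic {s} := cs.downR_mem {s} b
  have hqcJ : q * c ∈ cs.parabolic J := mul_mem (hS.singleton_le_J hqs) hf.right_parabolic
  have hu' : u = a * p * (q * c) := by
    rw [hf.eq_mul, ← hpq]; simp only [mul_assoc]
  by_cases hap : a * p ∈ cs.rightMin J
  · have h1 : cs.upR J u = a * p := by rw [hu']; exact cs.upR_mul hap hqcJ
    have h2 : cs.downR J u = q * c := by rw [hu']; exact cs.downR_mul hap hqcJ
    rw [h1, h2, cs.upR_mul hf.left_min hpH, cs.downR_mul hf.left_min hpH,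
      cs.upL_mul hf.right_min (hS.singleton_le_H hqs),
      cs.downL_mul hf.right_min (hS.singleton_le_H hqs), hpq]
  simp only [rightMin, Set.mem_ofPred_eq, not_forall, not_not] at hap
  obtain ⟨i, hi, hd⟩ := hap
  obtain ⟨hiH, hiC, hcomm | hmem⟩ :=
    hS.descent_mul hf.left_parabolic hf.left_min hpH hps hi hd
  · have hib := cs.commute_of_mem_parabolic hcomm hf.mid_parabolic
    have hai : cs.IsRightDescent a i := by
      rw [← isRightInversion_simple_iff_isRightDescent,
        cs.isRightInversion_mul_iff (cs.isReflection_simple i),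
        ← cs.commute_of_mem_parabolic hcomm hpH, mul_inv_cancel_right] at hd
      rcases hd with ⟨h1, _⟩ | ⟨h1, _⟩
      · rw [isRightInversion_simple_iff_isRightDescent] at h1
        exact absurd (cs.mem_of_isRightDescent hpH h1) hiH
      · rwa [isRightInversion_simple_iff_isRightDescent] at h1
    have hai' := cs.isRightDescent_iff.1 hai
    have hiK : i ∈ cs.complement (M 1) J := Or.inr hiC
    have hale := (cs.mul_simple_bruhatCovers hai).le
    have hsupp := cs.suppIn_mono H hale
    have hu'' : u = a * cs.simple i * b * (cs.simple i * c) := by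
      rw [hf.eq_mul, mul_assoc (a * cs.simple i), ← mul_assoc b, ← hib]
      simp [mul_assoc]
    have hlen := hf.length_eq
    have l1 := cs.length_mul_le (a * cs.simple i * b) (cs.simple i * c)
    have l2 := cs.length_mul_le (a * cs.simple i) b
    have l3 := cs.length_mul_le (cs.simple i) c
    rw [← hu''] at l1
    rw [length_simple] at l3
    have hicl : cs.length (cs.simple i * c) = cs.length c + 1 := by omega
    have hsuppc : cs.suppIn H (cs.simple i * c) ⊆ cs.suppIn H c := by
      rintro j ⟨hj, hjH⟩
      refine ⟨(cs.supp_mul_subset _ _ hj).resolve_left fun hj' => ?_, hjH⟩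
      rw [supp_simple, Set.mem_singleton_iff] at hj'
      exact hiH (hj' ▸ hjH)
    have haimin : a * cs.simple i ∈ cs.rightMin H := by
      intro j hj hdj
      have h1 := cs.not_isRightDescent_iff.1 (hf.left_min j hj)
      have h2 := cs.length_mul_simple (a * cs.simple j) i
      rw [mul_assoc, ← hcomm j hj, ← mul_assoc] at h2
      unfold IsRightDescent at hdj
      omega
    -- left descents in `H` are not created by a generator commuting with `W_H`
    have hicmin : cs.simple i * c ∈ cs.leftMin H := by
      intro j hj hdj
      rw [← isRightDescent_inv_iff, ← isRightInversion_simple_iff_isRightDescent, mul_inv_rev,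
        inv_simple, cs.isRightInversion_mul_iff (cs.isReflection_simple j)] at hdj
      rcases hdj with ⟨h1, _⟩ | ⟨h1, _⟩
      · rw [isRightInversion_simple_iff] at h1
        exact hiH (cs.simple_injective h1 ▸ hj)
      · rw [inv_simple, hcomm j hj, simple_mul_simple_cancel_right,
          isRightInversion_simple_iff_isRightDescent, isRightDescent_inv_iff] at h1
        exact hf.right_min j hj h1
    have hf' : cs.IsFactorization w J H M u (a * cs.simple i) b (cs.simple i * c) :=
      ⟨hu'', by omega, mul_mem hf.left_parabolic (cs.simple_mem_parabolic hiK), haimin,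
        (Set.encard_le_encard hsupp).trans hf.left_card, fun j hj => hf.left_comm j (hsupp hj),
        hf.mid_parabolic, mul_mem (cs.simple_mem_parabolic hi) hf.right_parabolic, hicmin,
        (Set.encard_le_encard hsuppc).trans hf.right_card,
        fun j hj => hf.right_comm j (hsuppc hj)⟩
    rw [← ih _ (by omega) hf' rfl]
    have hiM := cs.commute_of_mem_parabolic hcomm
      ((hS.matching b hbw).1.mem_parabolic (cs.longestBelow_mem H w))
    rw [mul_assoc (a * cs.simple i), ← mul_assoc (M b), ← hiM]
    simp [mul_assoc]
  · set v := a * p with hv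
    have hvK : v ∈ cs.parabolic (cs.complement (M 1) J) :=
      mul_mem hf.left_parabolic (cs.parabolic_mono hS.subset hpH)
    have hvd : cs.downR J v ∈ cs.parabolic (cs.commGens (M 1)) := by
      refine cs.parabolic_mono ?_ (cs.mem_parabolic_inter
        (cs.downR_mem J v) ((cs.downR_le J v).mem_parabolic hvK))
      rintro j ⟨hj, hjK⟩
      exact cs.mem_commGens_of_mem hj hjK
    have hsv := cs.commute_of_mem_parabolic (fun h hh => (hS.simple_commute hh).symm) hvd
    have hdJ := mul_mem (cs.downR_mem J v) hqcJ
    have hu3 : u = cs.upR J v * (cs.downR J v * (q * c)) := by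
      rw [← mul_assoc, cs.upR_mul_downR, ← hu']
    have h1 : cs.upR J u = cs.upR J v := by
      rw [hu3]; exact cs.upR_mul (cs.upR_mem J v) hdJ
    have h2 : cs.downR J u = cs.downR J v * (q * c) := by
      rw [hu3]; exact cs.downR_mul (cs.upR_mem J v) hdJ
    have hp0 : cs.downR H (cs.upR J u) ∈ cs.parabolic (cs.suppIn H a) := by
      refine cs.mem_parabolic_inter ?_ (cs.downR_mem H _)
      have hva : v ∈ cs.parabolic (cs.supp a) := mul_mem (cs.mem_parabolic_supp a)
        (cs.parabolic_mono Set.inter_subset_left hmem)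
      rw [h1]
      exact ((cs.downR_le H _).trans (cs.upR_le J v)).mem_parabolic hva
    have hval : a * M b * c = cs.upR J u * cs.simple s * cs.downR J u := by
      rw [← hpq, hS.map_mul_of_mem_suppIn hf.left_comm hmem hqs, h1, h2,
        mul_assoc (cs.upR J v), ← mul_assoc (cs.simple s), hsv]
      rw [mul_assoc (cs.downR J v), ← mul_assoc (cs.upR J v), cs.upR_mul_downR, hv]
      simp only [mul_assoc]
    rw [hval, hS.map_mul_of_mem_suppIn hf.left_comm hp0 (hS.downL_downR_mem u)]
    conv_lhs => rw [← cs.upR_mul_downR H (cs.upR J u), ← cs.downL_mul_upL H (cs.downR J u)]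
    simp only [mul_assoc]

end IsRightSystem

/-! ### Inversion of systems -/

/-- The map `x ↦ M(x⁻¹)⁻¹` on `[e, w⁻¹]` corresponding to `M` on `[e, w]`. -/
def invMap (M : W → W) : W → W := fun x => (M x⁻¹)⁻¹

theorem invMap_invMap (M : W → W) : invMap (invMap M) = M := by
  funext x; simp [invMap]

theorem complement_complement {x : W} {J : Set B} (h : cs.commGens x ⊆ J) :
    cs.complement x (cs.complement x J) = J := by
  ext i
  have := @h i
  simp only [complement, Set.mem_union, Set.mem_compl_iff]
  tauto

theorem commGens_subset_complement (x : W) (J : Set B) :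
    cs.commGens x ⊆ cs.complement x J := Set.subset_union_right

variable {cs}

theorem IsMatching.invMap {x : W} {M : W → W} (h : cs.IsMatching x M) :
    cs.IsMatching x⁻¹ (invMap M) := by
  intro u hu
  obtain ⟨h1, h2, h3⟩ := h u⁻¹ (cs.inv_bruhatLE.2 hu)
  refine ⟨h1.inv, by simp [CoxeterSystem.invMap, h2], h3.imp (fun h => ?_) fun h => ?_⟩ <;>
    simpa [CoxeterSystem.invMap] using h.inv

theorem IsMultiplication.invMap {x : W} {M : W → W} (h : cs.IsMultiplication x M) :
    cs.IsMultiplication x⁻¹ (invMap M) := by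
  refine h.symm.imp ?_ ?_ <;> rintro ⟨i, h⟩ <;> refine ⟨i, fun u hu => ?_⟩ <;>
    simp [CoxeterSystem.invMap, h u⁻¹ (cs.inv_bruhatLE.2 hu)]

theorem CommutesLeft.invMap {x : W} {M : W → W} {i : B} (h : cs.CommutesLeft x M i) :
    cs.CommutesRight x⁻¹ (invMap M) i := by
  intro u hu
  obtain ⟨h1, h2⟩ := h u⁻¹ (cs.inv_bruhatLE.2 hu)
  refine ⟨by simpa using h1.inv, ?_⟩
  simp only [CoxeterSystem.invMap, mul_inv_rev, inv_simple, h2]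

theorem CommutesRight.invMap {x : W} {M : W → W} {i : B} (h : cs.CommutesRight x M i) :
    cs.CommutesLeft x⁻¹ (invMap M) i := by
  intro u hu
  obtain ⟨h1, h2⟩ := h u⁻¹ (cs.inv_bruhatLE.2 hu)
  refine ⟨by simpa using h1.inv, ?_⟩
  simp only [CoxeterSystem.invMap, mul_inv_rev, inv_simple, h2]

theorem IsSystem.exists_map_one {w : W} {J H : Set B} {M : W → W} (hS : cs.IsSystem w J H M) :
    ∃ s ∈ H, M 1 = cs.simple s :=
  hS.matching.exists_simple_eq (cs.longestBelow_mem H w)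

theorem IsSystem.invMap_one {w : W} {J H : Set B} {M : W → W} (hS : cs.IsSystem w J H M) :
    invMap M 1 = M 1 := by
  obtain ⟨s, -, hs⟩ := hS.exists_map_one
  simp [invMap, hs]

/-- For `w ∈ W_K W_J` the minimal representative of `W_K w` lies in `W_J`. -/
theorem upL_mem_parabolic_of_upR_mem_parabolic {J K : Set B} {w : W}
    (h : cs.upR J w ∈ cs.parabolic K) : cs.upL K w ∈ cs.parabolic J := by
  have e : w = cs.upR J w * cs.downL K (cs.downR J w) * cs.upL K (cs.downR J w) := by
    rw [mul_assoc, cs.downL_mul_upL, cs.upR_mul_downR]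
  rw [e, cs.upL_mul (cs.upL_mem K _) (mul_mem h (cs.downL_mem K _))]
  exact (cs.upL_le K _).mem_parabolic (cs.downR_mem J w)

/-- Inversion interchanges the roles of `J` and `K`. -/
theorem IsSystem.inv {w : W} {J H : Set B} {M : W → W} (hS : cs.IsSystem w J H M) :
    cs.IsSystem w⁻¹ (cs.complement (M 1) J) H (invMap M) where
  card_eq := hS.card_eq
  matching := by
    rw [cs.longestBelow_inv]
    exact hS.matching.invMap
  commGens_subset := by
    rw [hS.invMap_one]
    exact cs.commGens_subset_complement _ _
  s0 := by
    rw [cs.longestBelow_inv, ← hS.s0]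
    refine ⟨fun h => ?_, fun h => h.invMap⟩
    have := h.invMap
    rwa [inv_inv, invMap_invMap] at this
  s1 := by
    rw [hS.invMap_one, cs.complement_complement hS.commGens_subset, cs.upR_inv]
    exact inv_mem (upL_mem_parabolic_of_upR_mem_parabolic hS.s1)
  s2_left_card := by
    rw [cs.upR_inv, cs.upR_inv, cs.suppIn_inv]
    exact hS.s2_right_card
  s2_left := by
    rw [cs.upR_inv, cs.upR_inv, cs.suppIn_inv, cs.longestBelow_inv]
    exact fun i hi => (hS.s2_right i hi).invMap
  s2_right_card := by
    rw [hS.invMap_one, cs.complement_complement hS.commGens_subset, cs.upL_inv, cs.upL_inv,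
      cs.suppIn_inv]
    exact hS.s2_left_card
  s2_right := by
    rw [hS.invMap_one, cs.complement_complement hS.commGens_subset, cs.upL_inv, cs.upL_inv,
      cs.suppIn_inv, cs.longestBelow_inv]
    exact fun i hi => (hS.s2_left i hi).invMap

theorem IsSystem.isFactorization_inv {w : W} {J H : Set B} {M : W → W}
    (hS : cs.IsSystem w J H M) {u a b c : W} (h : cs.IsFactorization w J H M u a b c) :
    cs.IsFactorization w⁻¹ (cs.complement (M 1) J) H (invMap M) u⁻¹ c⁻¹ b⁻¹ a⁻¹ where
  eq_mul := by rw [h.eq_mul]; simp only [mul_inv_rev, mul_assoc]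
  length_eq := by simp only [length_inv, h.length_eq]; omega
  left_parabolic := by
    rw [hS.invMap_one, cs.complement_complement hS.commGens_subset]
    exact inv_mem h.right_parabolic
  left_min := cs.inv_mem_rightMin_iff.2 h.right_min
  left_card := by rw [cs.suppIn_inv]; exact h.right_card
  left_comm := by
    rw [cs.suppIn_inv, cs.longestBelow_inv]
    exact fun i hi => (h.right_comm i hi).invMap
  mid_parabolic := inv_mem h.mid_parabolic
  right_parabolic := inv_mem h.left_parabolic
  right_min := cs.inv_mem_leftMin_iff.2 h.left_min
  right_card := by rw [cs.suppIn_inv]; exact h.left_card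
  right_comm := by
    rw [cs.suppIn_inv, cs.longestBelow_inv]
    exact fun i hi => (h.left_comm i hi).invMap

theorem IsSystem.isFactorization_of_inv {w : W} {J H : Set B} {M : W → W}
    (hS : cs.IsSystem w J H M) {u a b c : W}
    (h : cs.IsFactorization w⁻¹ (cs.complement (M 1) J) H (invMap M) u a b c) :
    cs.IsFactorization w J H M u⁻¹ c⁻¹ b⁻¹ a⁻¹ := by
  have := hS.inv.isFactorization_inv h
  rwa [inv_inv, hS.invMap_one, cs.complement_complement hS.commGens_subset,
    invMap_invMap] at this

/-! ### The map of a system -/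

/-- When `|H| = 2`, the two generators in `H` do not commute: otherwise `M` would be a
multiplication matching. -/
theorem IsSystem.exists_pair {w : W} {J H : Set B} {M : W → W} (hS : cs.IsSystem w J H M) :
    ∃ s t, M 1 = cs.simple s ∧ H = {s, t} ∧ (t ∈ cs.commGens (M 1) → t = s) := by
  obtain ⟨s, hsH, hs⟩ := hS.exists_map_one
  rcases hS.card_eq with h | h
  · obtain ⟨x, rfl⟩ := Set.encard_eq_one.1 h
    obtain rfl : s = x := hsH
    exact ⟨s, s, hs, by simp, fun _ => rfl⟩
  · obtain ⟨x, hx, hxs⟩ : ∃ x, x ≠ s ∧ H = {s, x} := by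
      obtain ⟨x, y, hxy, rfl⟩ := Set.encard_eq_two.1 h
      rcases hsH with rfl | rfl
      · exact ⟨y, hxy.symm, rfl⟩
      · exact ⟨x, hxy, Set.pair_comm _ _⟩
    refine ⟨s, x, hs, hxs, fun hc => ?_⟩
    exfalso
    have hc' : M 1 * cs.simple x = cs.simple x * M 1 := hc
    rw [hs] at hc'
    have h1 := hS.s0.1 (hS.matching.isMultiplication_of_commute hx.symm hc'
      (hxs ▸ cs.longestBelow_mem H w) hs)
    rw [h] at h1
    norm_num at h1

theorem IsSystem.isRightSystem {w : W} {J H : Set B} {M : W → W} (hS : cs.IsSystem w J H M)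
    (hH : H ⊆ cs.complement (M 1) J) : ∃ s t, cs.IsRightSystem w J H M s t := by
  obtain ⟨s, t, hs, hst, hc⟩ := hS.exists_pair
  refine ⟨s, t, hS, hs, hst, hH, fun i hi hiJ => ?_⟩
  have hiC := cs.mem_commGens_of_mem hiJ (hH hi)
  rw [hst] at hi
  rcases hi with rfl | rfl
  exacts [rfl, hc hiC]

theorem IsSystem.isRightSystem_inv {w : W} {J H : Set B} {M : W → W} (hS : cs.IsSystem w J H M)
    (hH : H ⊆ J) :
    ∃ s t, cs.IsRightSystem w⁻¹ (cs.complement (M 1) J) H (invMap M) s t := by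
  refine hS.inv.isRightSystem ?_
  rwa [hS.invMap_one, cs.complement_complement hS.commGens_subset]

theorem IsSystem.right_or_left {w : W} {J H : Set B} {M : W → W} (hS : cs.IsSystem w J H M) :
    H ⊆ cs.complement (M 1) J ∨ H ⊆ J := by
  obtain ⟨s, t, hs, hst, -⟩ := hS.exists_pair
  have hsC : s ∈ cs.commGens (M 1) := by simp [commGens, hs]
  by_cases ht : t ∈ J
  · right
    rw [hst]
    rintro i (rfl | rfl)
    exacts [hS.commGens_subset hsC, ht]
  · left
    rw [hst]
    rintro i (rfl | rfl)
    exacts [Or.inr hsC, Or.inl ht]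

/-- Every `u ≤ w` has a factorization `u = a b c` that computes `M_𝒮(u)` and for which
`a · M(b) · c` is again a factorization. -/
theorem IsSystem.exists_isFactorization {w : W} {J H : Set B} {M : W → W}
    (hS : cs.IsSystem w J H M) {u : W} (hu : cs.BruhatLE u w) :
    ∃ a b c, cs.IsFactorization w J H M u a b c ∧
      cs.IsFactorization w J H M (a * M b * c) a (M b) c ∧
      ∀ a' b' c', cs.IsFactorization w J H M u a' b' c' → a' * M b' * c' = a * M b * c := by
  rcases hS.right_or_left with h | h
  · obtain ⟨s, t, hR⟩ := hS.isRightSystem h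
    exact ⟨_, _, _, hR.isFactorization_canonical hu,
      hR.isFactorization_map_canonical hu rfl rfl rfl, fun a' b' c' h => hR.mul_map_mul_eq hu h⟩
  · obtain ⟨s, t, hR⟩ := hS.isRightSystem_inv h
    have h1 := hS.isFactorization_of_inv (hR.isFactorization_canonical hu.inv)
    have h2 := hS.isFactorization_of_inv
      (hR.isFactorization_map_canonical hu.inv rfl rfl rfl)
    rw [inv_inv] at h1
    refine ⟨_, _, _, h1, ?_, fun a' b' c' h => ?_⟩
    · convert h2 using 1
      · simp [invMap, mul_assoc]
      · simp [invMap]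
    · have := hR.mul_map_mul_eq hu.inv (hS.isFactorization_inv h)
      rw [← inv_inj]
      convert this using 1 <;> simp [invMap, mul_assoc]

theorem IsSystem.systemMap_eq {w : W} {J H : Set B} {M : W → W}
    (hS : cs.IsSystem w J H M) {u : W} (hu : cs.BruhatLE u w) {a b c : W}
    (hf : cs.IsFactorization w J H M u a b c) : cs.systemMap w J H M u = a * M b * c := by
  obtain ⟨a', b', c', -, -, huniq⟩ := hS.exists_isFactorization hu
  have h : ∃ p : W × W × W, cs.IsFactorization w J H M u p.1 p.2.1 p.2.2 := ⟨(a, b, c), hf⟩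
  rw [systemMap, dif_pos h, huniq _ _ _ h.choose_spec, huniq _ _ _ hf]

/-- If `M_𝒮(w) ⊲ w` then `M_𝒮` maps `[e, w]` to itself: write `w = a b c`, so that `M(b) ⊲ b`, and
`u = a' b' c'` with `a' ≤ a`, `b' ≤ b`, `c' ≤ c`. Then `M_𝒮(u) = a' M(b') c'`, because the
`W_H`-parts of `a'` and `c'` can be pulled through `M`, and `M(b') ≤ b`. -/
theorem IsSystem.systemMap_le {w : W} {J H : Set B} {M : W → W}
    (hS : cs.IsSystem w J H M) (hw : cs.length (cs.systemMap w J H M w) < cs.length w)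
    {u : W} (hu : cs.BruhatLE u w) : cs.BruhatLE (cs.systemMap w J H M u) w := by
  obtain ⟨s, t, -, hst, -⟩ := hS.exists_pair
  obtain ⟨a, b, c, hf, hf', -⟩ := hS.exists_isFactorization (cs.bruhatLE_refl w)
  rw [hS.systemMap_eq (cs.bruhatLE_refl w) hf, hf'.length_eq, hf.length_eq] at hw
  have hbw := IsRightSystem.mid_le hf (cs.bruhatLE_refl w)
  have habc : cs.length (a * b * c) = cs.length (a * b) + cs.length c ∧
      cs.length (a * b) = cs.length a + cs.length b := by
    have h1 := hf.length_eq
    rw [hf.eq_mul] at h1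
    have := cs.length_mul_le a b
    have := cs.length_mul_le (a * b) c
    omega
  have hu' := hu
  rw [hf.eq_mul] at hu'
  obtain ⟨y, c', hy, hc', rfl, hl1⟩ := cs.exists_eq_mul_of_bruhatLE_mul habc.1 hu'
  obtain ⟨a', b', ha', hb', rfl, hl2⟩ := cs.exists_eq_mul_of_bruhatLE_mul habc.2 hy
  set α := cs.downR H a' with hα
  set γ := cs.downL H c' with hγ
  have hαa : α ∈ cs.parabolic (cs.suppIn H a) := cs.mem_parabolic_inter
    (((cs.downR_le H a').trans ha').mem_parabolic (cs.mem_parabolic_supp a))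
    (cs.downR_mem H a')
  have hγc : γ ∈ cs.parabolic (cs.suppIn H c) := cs.mem_parabolic_inter
    (((cs.downL_le H c').trans hc').mem_parabolic (cs.mem_parabolic_supp c))
    (cs.downL_mem H c')
  have ha'' := (cs.upR_le H a').trans ha'
  have hc'' := (cs.upL_le H c').trans hc'
  have m1 := CommutesLeft.mul hf.left_comm hαa (hb'.trans hbw)
  have m2 := CommutesRight.mul hf.right_comm hγc m1.1
  have hfu : cs.IsFactorization w J H M (a' * b' * c') (cs.upR H a') (α * b' * γ)
      (cs.upL H c') := by
    have e : a' * b' * c' = cs.upR H a' * (α * b' * γ) * cs.upL H c' := by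
      conv_lhs => rw [← cs.upR_mul_downR H a', ← cs.downL_mul_upL H c']
      simp only [hα, hγ, mul_assoc]
    refine ⟨e, ?_, ha''.mem_parabolic hf.left_parabolic, cs.upR_mem H a',
      (Set.encard_le_encard (cs.suppIn_mono H ha'')).trans hf.left_card,
      fun i hi => hf.left_comm i (cs.suppIn_mono H ha'' hi),
      m2.1.mem_parabolic (cs.longestBelow_mem H w),
      hc''.mem_parabolic hf.right_parabolic, cs.upL_mem H c',
      (Set.encard_le_encard (cs.suppIn_mono H hc'')).trans hf.right_card,
      fun i hi => hf.right_comm i (cs.suppIn_mono H hc'' hi)⟩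
    have h1 := cs.length_upR_add H a'
    have h2 := cs.length_downL_add H c'
    rw [← hα] at h1
    rw [← hγ] at h2
    have h3 := cs.length_mul_le α b'
    have h4 := cs.length_mul_le (α * b') γ
    have h5 := cs.length_mul_le (cs.upR H a') (α * b' * γ)
    have h6 := cs.length_mul_le (cs.upR H a' * (α * b' * γ)) (cs.upL H c')
    rw [← e] at h6
    omega
  have hval : cs.systemMap w J H M (a' * b' * c') = a' * M b' * c' := by
    rw [hS.systemMap_eq hu hfu, m2.2, m1.2]
    conv_rhs => rw [← cs.upR_mul_downR H a', ← cs.downL_mul_upL H c']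
    simp only [hα, hγ, mul_assoc]
  rw [hval]
  conv_rhs => rw [hf.eq_mul]
  refine cs.mul_bruhatLE_mul habc.1 (cs.mul_bruhatLE_mul habc.2 ha' ?_) hc'
  exact hS.matching.le_of_le (i := s) (j := t) (by rw [← hst]; exact cs.longestBelow_mem H w) hbw
    (by omega) hb'

theorem IsSystem.isMatching_systemMap {w : W} {J H : Set B} {M : W → W}
    (hS : cs.IsSystem w J H M) (hw : cs.length (cs.systemMap w J H M w) < cs.length w) :
    cs.IsMatching w (cs.systemMap w J H M) := by
  intro u hu
  have hle := hS.systemMap_le hw hu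
  obtain ⟨a, b, c, hf, hf', -⟩ := hS.exists_isFactorization hu
  have hb := hS.matching b (IsRightSystem.mid_le hf hu)
  have hval := hS.systemMap_eq hu hf
  refine ⟨hle, ?_, ?_⟩
  · rw [hval] at hle ⊢
    rw [hS.systemMap_eq hle hf', hb.2.1, ← hf.eq_mul]
  · have conj : ∀ x y, cs.IsReflection (x⁻¹ * y) →
        cs.IsReflection ((a * x * c)⁻¹ * (a * y * c)) := by
      intro x y h
      have := h.conj c⁻¹
      simpa [mul_assoc] using this
    have l1 := hf.length_eq
    have l2 := hf'.length_eq
    have e := hf.eq_mul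
    rw [hval]
    refine hb.2.2.imp (fun h => ⟨?_, ?_⟩) (fun h => ⟨?_, ?_⟩)
    · have := conj _ _ h.1
      rwa [← e] at this
    · have := h.2
      omega
    · have := conj _ _ h.1
      rwa [← e] at this
    · have := h.2
      omega

end CoxeterSystem

theorem mainTheorem7 {B W : Type*} [Group W] {A : CoxeterMatrix B} (cs : CoxeterSystem A W)
    (w : W) (J H : Set B) (M : W → W) (hS : cs.IsSystem w J H M) :
    -- `M_𝒮` is well defined on `[e, w]`
    (∀ u, cs.BruhatLE u w →
      (∃ a b c, cs.IsFactorization w J H M u a b c) ∧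
      ∀ a b c, cs.IsFactorization w J H M u a b c →
        cs.systemMap w J H M u = a * M b * c) ∧
    (cs.BruhatCovers (cs.systemMap w J H M w) w →
      (∀ u, cs.BruhatLE u w → cs.BruhatLE (cs.systemMap w J H M u) w) ∧
      cs.IsMatching w (cs.systemMap w J H M) ∧
      -- the inequality of axiom R2, when `H ⊆ K`
      (H ⊆ cs.complement (M 1) J → ∀ u, cs.BruhatLE u w →
        cs.BruhatLE (cs.upR H (cs.upR J u) *
          M (cs.downR H (cs.upR J u) * cs.downL H (cs.downR J u)) *
          cs.upL H (cs.downR J u)) w) ∧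
      -- the inequality of axiom L2, when `H ⊆ J`
      (H ⊆ J → ∀ u, cs.BruhatLE u w →
        cs.BruhatLE (cs.upR H (cs.downL (cs.complement (M 1) J) u) *
          M (cs.downR H (cs.downL (cs.complement (M 1) J) u) *
            cs.downL H (cs.upL (cs.complement (M 1) J) u)) *
          cs.upL H (cs.upL (cs.complement (M 1) J) u)) w)) := by
  refine ⟨fun u hu => ?_, fun hw => ⟨fun u hu => ?_, ?_, fun hH u hu => ?_, fun hH u hu => ?_⟩⟩
  · obtain ⟨a, b, c, hf, -, -⟩ := hS.exists_isFactorization hu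
    exact ⟨⟨a, b, c, hf⟩, fun _ _ _ h => hS.systemMap_eq hu h⟩
  · exact hS.systemMap_le (by have := hw.2; omega) hu
  · exact hS.isMatching_systemMap (by have := hw.2; omega)
  · obtain ⟨s, t, hR⟩ := hS.isRightSystem hH
    rw [← hS.systemMap_eq hu (hR.isFactorization_canonical hu)]
    exact hS.systemMap_le (by have := hw.2; omega) hu
  · obtain ⟨s, t, hR⟩ := hS.isRightSystem_inv hH
    have hf := hS.isFactorization_of_inv (hR.isFactorization_canonical hu.inv)
    simp only [inv_inv, cs.upR_inv, cs.downR_inv, cs.upL_inv, cs.downL_inv, mul_inv_rev] at hf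
    rw [← hS.systemMap_eq hu hf]
    exact hS.systemMap_le (by have := hw.2; omega) hu
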